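/- Let $k$ be a field and let $A=\bigoplus_{n\ge 0}A_n$ be a connected graded $k$-algebra ($A_0=k$) that is generated by $A_1$, with $\dim_k A_1<\infty$. Let $D\in\{2,3\}$, and assume that $A$ is AS-Gorenstein of global dimension $D$: the (left) global dimension of $A$ equals $D$, and, for the trivial left module $k=A/A_{\ge 1}$ and with $\mathrm{Ext}$ computed in the category of all left $A$-modules, $\mathrm{Ext}^i_A(k,A)=0$ for every $i\ne D$, while $\mathrm{Ext}^D_A(k,A)\cong k$ as $k$-vector spaces. Then there is an integer $N\ge 2$, with $N=2$ if $D=2$, such that $A$ is $N$-homogeneous and (generalized) Koszul, that is: (a) as a graded algebra, $A$ is isomorphic to a quotient $\mathrm{Tens}(V)/(R)$, where $V$ is a finite-dimensional vector space placed in degree $1$, $R$ is a subspace of $V^{\otimes N}$, and $(R)$ is the two-sided ideal generated by $R$; (b) for every $i\ge 3$, the graded vector space $\mathrm{Tor}_i^A(k,k)$ is concentrated in degree $n(i)$, where $n(2q)=qN$ and $n(2q+1)=qN+1$ for every integer $q\ge 0$. -/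

import Mathlib

open CategoryTheory

universe u v

/-- A graded left module over the `ℕ`-graded ring `(A, 𝒜)`: a left `A`-module `M = ⨁_{n ∈ ℤ} M_n`
with `A_m M_n ⊆ M_{m+n}`. -/
structure GradedLeftModule {k : Type v} {A : Type u} [Field k] [Ring A] [Algebra k A]
    (𝒜 : ℕ → Submodule k A) where
  carrier : Type u
  [addCommGroup : AddCommGroup carrier]
  [module : Module A carrier]
  deg : ℤ → AddSubgroup carrier
  isInternal : DirectSum.IsInternal deg
  smul_mem : ∀ {m : ℕ} {n : ℤ} {a : A} {x : carrier},
    a ∈ 𝒜 m → x ∈ deg n → a • x ∈ deg (m + n)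

attribute [instance] GradedLeftModule.addCommGroup GradedLeftModule.module

section

variable {k : Type v} {A : Type u} [Field k] [Ring A] [Algebra k A] (𝒜 : ℕ → Submodule k A)

/-- A graded algebra is connected when the unit map `k → A` is injective with image `A_0`,
that is, `A_0 = k`. -/
def IsConnectedGraded : Prop :=
  Function.Injective (algebraMap k A) ∧ 𝒜 0 = LinearMap.range (Algebra.linearMap k A)

variable (A) in
/-- The (left) global dimension of the ring `A` is equal to the natural number `D`. -/
def HasGlobalDimension (D : ℕ) : Prop :=
  IsLeast {d : ℕ | ∀ M : ModuleCat.{u} A, HasProjectiveDimensionLE M d} D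

/-- `A` is `N`-homogeneous: as a graded algebra, it is the quotient of the tensor algebra
`Tens(V)` of a finite-dimensional space `V` placed in degree `1`, by the two-sided ideal generated
by a subspace `R` of `V^{⊗N}`, where `N ≥ 2`. The quotient map is `φ`; as it is surjective and
maps `V` into `A_1`, it maps `V^{⊗n}` onto `A_n` for all `n`. -/
def IsNHomogeneous (N : ℕ) : Prop :=
  2 ≤ N ∧ ∃ (V : Type u) (_ : AddCommGroup V) (_ : Module k V) (_ : Module.Finite k V)
    (R : Submodule k (TensorAlgebra k V)) (φ : TensorAlgebra k V →ₐ[k] A),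
    R ≤ LinearMap.range (TensorAlgebra.ι k : V →ₗ[k] TensorAlgebra k V) ^ N ∧
    (∀ x : V, φ (TensorAlgebra.ι k x) ∈ 𝒜 1) ∧
    Function.Surjective φ ∧
    TwoSidedIdeal.ker φ = TwoSidedIdeal.span (R : Set (TensorAlgebra k V))

/-- The jump map `n(2q) = qN`, `n(2q+1) = qN + 1`. -/
def jumpMap (N i : ℕ) : ℕ := (i / 2) * N + i % 2

variable [GradedAlgebra 𝒜]

/-- The trivial left `A`-module `k = A / A_{≥ 1}`. -/
abbrev TrivialModule : Type u := A ⧸ (HomogeneousIdeal.irrelevant 𝒜).toIdeal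

/-- A connected graded algebra `A` of finite global dimension `D` is (left) AS-Gorenstein if
`Ext^i_A(k, A) = 0` for `i ≠ D` and `Ext^D_A(k, A) = k`. Here `Ext` is computed in the category of
all (ungraded) left `A`-modules. -/
def IsASGorenstein (D : ℕ) : Prop :=
  HasGlobalDimension A D ∧
  (∀ i : ℕ, i ≠ D →
    Subsingleton (Abelian.Ext (ModuleCat.of A (TrivialModule 𝒜)) (ModuleCat.of A A) i)) ∧
  Nonempty (Abelian.Ext (ModuleCat.of A (TrivialModule 𝒜)) (ModuleCat.of A A) D ≃ₗ[k] k)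

/-- A resolution `⋯ → X_2 → X_1 → X_0 → k → 0` of the trivial module `k` (placed in degree `0`) by
projective graded left modules, with maps homogeneous of degree `0`. -/
structure GradedProjectiveResolution where
  X : ℕ → GradedLeftModule 𝒜
  projective : ∀ i, Module.Projective A (X i).carrier
  d : ∀ i, (X (i + 1)).carrier →ₗ[A] (X i).carrier
  d_mem : ∀ i n x, x ∈ (X (i + 1)).deg n → d i x ∈ (X i).deg n
  aug : (X 0).carrier →ₗ[A] TrivialModule 𝒜
  aug_deg : ∀ n, n ≠ 0 → ∀ x ∈ (X 0).deg n, aug x = 0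
  aug_surjective : Function.Surjective aug
  exact_zero : Function.Exact (d 0) aug
  exact_succ : ∀ i, Function.Exact (d (i + 1)) (d i)

namespace GradedProjectiveResolution

variable {𝒜} (P : GradedProjectiveResolution 𝒜)

/-- The submodule `A_{≥ 1} X_i` of `X_i`. -/
def augSub (i : ℕ) : Submodule A (P.X i).carrier :=
  Submodule.span A {y | ∃ a ∈ HomogeneousIdeal.irrelevant 𝒜, ∃ x : (P.X i).carrier, a • x = y}

lemma augSub_le_comap (i : ℕ) : P.augSub (i + 1) ≤ (P.augSub i).comap (P.d i) := by
  refine Submodule.span_le.2 ?_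
  rintro _ ⟨a, ha, x, rfl⟩
  exact Submodule.subset_span ⟨a, ha, P.d i x, (map_smul _ _ _).symm⟩

/-- The module `k ⊗_A X_i = X_i / A_{≥ 1} X_i`. -/
abbrev Coinv (i : ℕ) : Type u := (P.X i).carrier ⧸ P.augSub i

/-- The differential of the complex `k ⊗_A X`. -/
def coinvD (i : ℕ) : P.Coinv (i + 1) →ₗ[A] P.Coinv i :=
  (P.augSub (i + 1)).mapQ (P.augSub i) (P.d i) (P.augSub_le_comap i)

/-- The degree `n` part of `k ⊗_A X_i`. -/
def coinvDeg (i : ℕ) (n : ℤ) : AddSubgroup (P.Coinv i) :=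
  ((P.X i).deg n).map (P.augSub i).mkQ.toAddMonoidHom

/-- The cycles of the complex `⋯ → k ⊗_A X_1 → k ⊗_A X_0 → 0`. -/
def coinvCycles : ∀ i : ℕ, AddSubgroup (P.Coinv i)
  | 0 => ⊤
  | i + 1 => (P.coinvD i).toAddMonoidHom.ker

/-- The boundaries of degree `n`. -/
def coinvBoundaries (i : ℕ) (n : ℤ) : AddSubgroup (P.Coinv i) :=
  (P.coinvDeg (i + 1) n).map (P.coinvD i).toAddMonoidHom

/-- The component of degree `n` of the graded space `Tor_i^A(k, k)`, as the homology of the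
degree `n` part of the complex `k ⊗_A X`. -/
abbrev Tor (i : ℕ) (n : ℤ) : Type u :=
  ↥(P.coinvCycles i ⊓ P.coinvDeg i n) ⧸
    (P.coinvBoundaries i n).addSubgroupOf (P.coinvCycles i ⊓ P.coinvDeg i n)

end GradedProjectiveResolution

/-- The (generalized) Koszul property of an `N`-homogeneous algebra: for `i ≥ 3`, the graded space
`Tor_i^A(k, k)` is concentrated in degree `n(i)`. Here `Tor` is computed by a graded projective
resolution of `k`; the choice of the resolution is irrelevant, see `isGeneralizedKoszul_iff`. -/
def IsGeneralizedKoszul (N : ℕ) : Prop :=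
  ∃ P : GradedProjectiveResolution 𝒜, ∀ i, 3 ≤ i → ∀ n : ℤ, n ≠ jumpMap N i →
    Subsingleton (P.Tor i n)

end

/-! The graded pieces of `Tor` do not depend on the resolution. -/

namespace GradedLeftModule

variable {k : Type v} {A : Type u} [Field k] [Ring A] [Algebra k A] {𝒜 : ℕ → Submodule k A}

lemma induct (M : GradedLeftModule 𝒜) {p : M.carrier → Prop} (h0 : p 0)
    (hh : ∀ n, ∀ x ∈ M.deg n, p x) (hadd : ∀ x y, p x → p y → p (x + y)) (x : M.carrier) : p x := by
  let := M.isInternal.chooseDecomposition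
  exact DirectSum.Decomposition.inductionOn M.deg h0 (fun m => hh _ _ m.2) hadd x

/-- The projection onto the component of degree `n`. -/
noncomputable def pr (M : GradedLeftModule 𝒜) (n : ℤ) : M.carrier →+ M.carrier :=
  letI := M.isInternal.chooseDecomposition
  ((M.deg n).subtype.comp
    (DFinsupp.evalAddMonoidHom (β := fun i => ↥(M.deg i)) n)).comp
    (DirectSum.decomposeAddEquiv M.deg).toAddMonoidHom

lemma pr_mem (M : GradedLeftModule 𝒜) (n : ℤ) (x : M.carrier) : M.pr n x ∈ M.deg n := by
  let := M.isInternal.chooseDecomposition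
  exact (DirectSum.decompose M.deg x n).2

lemma pr_of_mem (M : GradedLeftModule 𝒜) {n : ℤ} {x : M.carrier} (hx : x ∈ M.deg n) :
    M.pr n x = x := by
  let := M.isInternal.chooseDecomposition
  exact DirectSum.decompose_of_mem_same M.deg hx

lemma pr_of_mem_ne (M : GradedLeftModule 𝒜) {m n : ℤ} {x : M.carrier} (hx : x ∈ M.deg m)
    (h : m ≠ n) : M.pr n x = 0 := by
  let := M.isInternal.chooseDecomposition
  exact DirectSum.decompose_of_mem_ne M.deg hx h

lemma pr_smul (M : GradedLeftModule 𝒜) {m : ℕ} {a : A} (ha : a ∈ 𝒜 m) (n : ℤ) (x : M.carrier) :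
    M.pr (m + n) (a • x) = a • M.pr n x := by
  induction x using M.induct with
  | h0 => simp
  | hh j x hx =>
    by_cases h : j = n
    · subst h
      rw [M.pr_of_mem hx, M.pr_of_mem (M.smul_mem ha hx)]
    · rw [M.pr_of_mem_ne hx h, M.pr_of_mem_ne (M.smul_mem ha hx) (by omega), smul_zero]
  | hadd x y hx hy => simp only [smul_add, map_add, hx, hy]

lemma map_pr {M N : GradedLeftModule 𝒜} (e : M.carrier →ₗ[A] N.carrier)
    (he : ∀ n, ∀ x ∈ M.deg n, e x ∈ N.deg n) (n : ℤ) (x : M.carrier) :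
    e (M.pr n x) = N.pr n (e x) := by
  induction x using M.induct with
  | h0 => simp
  | hh j x hx =>
    by_cases h : j = n
    · subst h
      rw [M.pr_of_mem hx, N.pr_of_mem (he _ _ hx)]
    · rw [M.pr_of_mem_ne hx h, N.pr_of_mem_ne (he _ _ hx) h, map_zero]
  | hadd x y hx hy => simp only [map_add, hx, hy]

lemma exists_degree_zero [GradedAlgebra 𝒜] {M N : GradedLeftModule 𝒜}
    (f : M.carrier →ₗ[A] N.carrier) :
    ∃ g : M.carrier →ₗ[A] N.carrier, ∀ n, ∀ x ∈ M.deg n, g x = N.pr n (f x) := by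
  let := M.isInternal.chooseDecomposition
  let g : M.carrier →+ N.carrier :=
    (DirectSum.toAddMonoid fun n : ℤ =>
      ((N.pr n).comp f.toAddMonoidHom).comp (M.deg n).subtype).comp
    (DirectSum.decomposeAddEquiv M.deg).toAddMonoidHom
  have hg : ∀ n, ∀ x ∈ M.deg n, g x = N.pr n (f x) := by
    intro n x hx
    simp [g, DirectSum.decompose_of_mem M.deg hx]
  refine ⟨{ g with map_smul' := fun a x => ?_ }, hg⟩
  change g (a • x) = a • g x
  induction a using DirectSum.Decomposition.inductionOn 𝒜 with
  | zero => simp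
  | @homogeneous m a =>
    induction x using M.induct with
    | h0 => simp
    | hh j x hx =>
      rw [hg _ _ hx, hg _ _ (M.smul_mem a.2 hx), map_smul, N.pr_smul a.2]
    | hadd x y hx hy => simp only [smul_add, map_add, hx, hy]
  | add a b ha hb => simp only [add_smul, map_add, ha, hb]

lemma exists_lift [GradedAlgebra 𝒜] {P M N : GradedLeftModule 𝒜} (hP : Module.Projective A P.carrier)
    (f : P.carrier →ₗ[A] M.carrier) (hf : ∀ n, ∀ x ∈ P.deg n, f x ∈ M.deg n)
    (e : N.carrier →ₗ[A] M.carrier) (he : ∀ n, ∀ x ∈ N.deg n, e x ∈ M.deg n)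
    (h : ∀ x, f x ∈ LinearMap.range e) :
    ∃ l : P.carrier →ₗ[A] N.carrier, (∀ n, ∀ x ∈ P.deg n, l x ∈ N.deg n) ∧ ∀ x, e (l x) = f x := by
  obtain ⟨l, hl⟩ := Module.projective_lifting_property e.rangeRestrict
    (f.codRestrict (LinearMap.range e) h) e.surjective_rangeRestrict
  have hl' : ∀ x, e (l x) = f x := fun x => congrArg Subtype.val (LinearMap.congr_fun hl x)
  obtain ⟨g, hg⟩ := exists_degree_zero l
  refine ⟨g, fun n x hx => by rw [hg n x hx]; exact N.pr_mem _ _, fun x => ?_⟩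
  induction x using P.induct with
  | h0 => simp
  | hh j x hx => rw [hg _ _ hx, map_pr e he, hl', M.pr_of_mem (hf _ _ hx)]
  | hadd x y hx hy => simp only [map_add, hx, hy]

end GradedLeftModule

namespace GradedProjectiveResolution

variable {k : Type v} {A : Type u} [Field k] [Ring A] [Algebra k A] {𝒜 : ℕ → Submodule k A}
  [GradedAlgebra 𝒜]

lemma exists_lift_aug (P Q : GradedProjectiveResolution 𝒜) :
    ∃ l : (P.X 0).carrier →ₗ[A] (Q.X 0).carrier,
      (∀ n, ∀ x ∈ (P.X 0).deg n, l x ∈ (Q.X 0).deg n) ∧ ∀ x, Q.aug (l x) = P.aug x := by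
  have := P.projective 0
  obtain ⟨l, hl⟩ := Module.projective_lifting_property Q.aug P.aug Q.aug_surjective
  have hl' : ∀ x, Q.aug (l x) = P.aug x := fun x => LinearMap.congr_fun hl x
  have hpr : ∀ x, Q.aug ((Q.X 0).pr 0 x) = Q.aug x := by
    intro x
    induction x using (Q.X 0).induct with
    | h0 => simp
    | hh j x hx =>
      by_cases h : j = 0
      · subst h
        rw [(Q.X 0).pr_of_mem hx]
      · rw [(Q.X 0).pr_of_mem_ne hx h, map_zero, Q.aug_deg j h x hx]
    | hadd x y hx hy => simp only [map_add, hx, hy]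
  obtain ⟨g, hg⟩ := GradedLeftModule.exists_degree_zero l
  refine ⟨g, fun n x hx => by rw [hg n x hx]; exact (Q.X 0).pr_mem _ _, fun x => ?_⟩
  induction x using (P.X 0).induct with
  | h0 => simp
  | hh j x hx =>
    rw [hg _ _ hx]
    by_cases h : j = 0
    · subst h
      rw [hpr, hl']
    · rw [Q.aug_deg j h _ ((Q.X 0).pr_mem _ _), P.aug_deg j h x hx]
  | hadd x y hx hy => simp only [map_add, hx, hy]

lemma aug_d (P : GradedProjectiveResolution 𝒜) (x) : P.aug (P.d 0 x) = 0 :=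
  P.exact_zero.apply_apply_eq_zero x

lemma d_d (P : GradedProjectiveResolution 𝒜) (i x) : P.d i (P.d (i + 1) x) = 0 :=
  (P.exact_succ i).apply_apply_eq_zero x

/-- A morphism between two resolutions. -/
lemma exists_comparison (P Q : GradedProjectiveResolution 𝒜) :
    ∃ f : ∀ i, (P.X i).carrier →ₗ[A] (Q.X i).carrier,
      (∀ i n, ∀ x ∈ (P.X i).deg n, f i x ∈ (Q.X i).deg n) ∧
      (∀ x, Q.aug (f 0 x) = P.aug x) ∧ ∀ i x, Q.d i (f (i + 1) x) = f i (P.d i x) := by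
  let S : ℕ → Type u := fun i => {f : (P.X i).carrier →ₗ[A] (Q.X i).carrier //
    (∀ n, ∀ x ∈ (P.X i).deg n, f x ∈ (Q.X i).deg n) ∧
      ∀ x, f (P.d i x) ∈ LinearMap.range (Q.d i)}
  obtain ⟨f0, hf0, hf0'⟩ := exists_lift_aug P Q
  let s0 : S 0 := ⟨f0, hf0, fun x => (Q.exact_zero _).1 (by rw [hf0', aug_d])⟩
  have step : ∀ i (s : S i), ∃ t : S (i + 1), ∀ x, Q.d i (t.1 x) = s.1 (P.d i x) := by
    rintro i ⟨f, hf, hf'⟩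
    obtain ⟨l, hl, hl'⟩ := GradedLeftModule.exists_lift (P.projective (i + 1))
      (f.comp (P.d i)) (fun n x hx => hf _ _ (P.d_mem _ _ _ hx)) (Q.d i)
      (fun n x hx => Q.d_mem _ _ _ hx) hf'
    exact ⟨⟨l, hl, fun x => (Q.exact_succ i _).1 (by rw [hl']; simp [d_d])⟩, hl'⟩
  choose nxt hnxt using step
  let F : ∀ i, S i := fun i => Nat.rec s0 nxt i
  exact ⟨fun i => (F i).1, fun i => (F i).2.1, hf0', fun i x => hnxt i (F i) x⟩

/-- An endomorphism of a resolution that lifts zero is homotopic to zero. -/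
lemma exists_homotopy (Q : GradedProjectiveResolution 𝒜)
    (p : ∀ i, (Q.X i).carrier →ₗ[A] (Q.X i).carrier)
    (hp : ∀ i n, ∀ x ∈ (Q.X i).deg n, p i x ∈ (Q.X i).deg n)
    (hp0 : ∀ x, Q.aug (p 0 x) = 0) (hpd : ∀ i x, Q.d i (p (i + 1) x) = p i (Q.d i x)) :
    ∃ h : ∀ i, (Q.X i).carrier →ₗ[A] (Q.X (i + 1)).carrier,
      (∀ i n, ∀ x ∈ (Q.X i).deg n, h i x ∈ (Q.X (i + 1)).deg n) ∧
      (∀ x, p 0 x = Q.d 0 (h 0 x)) ∧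
      ∀ i x, p (i + 1) x = Q.d (i + 1) (h (i + 1) x) + h i (Q.d i x) := by
  let S : ℕ → Type u := fun i => {h : (Q.X i).carrier →ₗ[A] (Q.X (i + 1)).carrier //
    (∀ n, ∀ x ∈ (Q.X i).deg n, h x ∈ (Q.X (i + 1)).deg n) ∧
      ∀ x, Q.d i (p (i + 1) x - h (Q.d i x)) = 0}
  obtain ⟨h0, hh0, hh0'⟩ := GradedLeftModule.exists_lift (Q.projective 0) (p 0) (hp 0) (Q.d 0)
    (fun n x hx => Q.d_mem _ _ _ hx) (fun x => (Q.exact_zero _).1 (hp0 x))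
  let s0 : S 0 := ⟨h0, hh0, fun x => by rw [map_sub, hpd, hh0', sub_self]⟩
  have step : ∀ i (s : S i), ∃ t : S (i + 1),
      ∀ x, p (i + 1) x = Q.d (i + 1) (t.1 x) + s.1 (Q.d i x) := by
    rintro i ⟨h, hh, hh'⟩
    obtain ⟨l, hl, hl'⟩ := GradedLeftModule.exists_lift (Q.projective (i + 1))
      (p (i + 1) - h.comp (Q.d i))
      (fun n x hx => AddSubgroup.sub_mem _ (hp _ _ _ hx) (hh _ _ (Q.d_mem _ _ _ hx)))
      (Q.d (i + 1)) (fun n x hx => Q.d_mem _ _ _ hx) (fun x => (Q.exact_succ i _).1 (hh' x))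
    refine ⟨⟨l, hl, fun x => ?_⟩, fun x => ?_⟩
    · rw [map_sub, hpd, hl']
      simp [d_d]
    · rw [hl']
      simp
  choose nxt hnxt using step
  let F : ∀ i, S i := fun i => Nat.rec s0 nxt i
  exact ⟨fun i => (F i).1, fun i => (F i).2.1, fun x => (hh0' x).symm,
    fun i x => hnxt i (F i) x⟩

lemma map_augSub {M : Type*} [AddCommGroup M] [Module A M] (P : GradedProjectiveResolution 𝒜)
    {i : ℕ} (S : Submodule A M) (f : (P.X i).carrier →ₗ[A] M)
    (hS : ∀ a ∈ HomogeneousIdeal.irrelevant 𝒜, ∀ y : M, a • y ∈ S) {x : (P.X i).carrier}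
    (hx : x ∈ P.augSub i) : f x ∈ S := by
  have : P.augSub i ≤ S.comap f := by
    refine Submodule.span_le.2 ?_
    rintro _ ⟨a, ha, x, rfl⟩
    simpa using hS a ha (f x)
  exact this hx

lemma smul_mem_augSub (P : GradedProjectiveResolution 𝒜) (i : ℕ) :
    ∀ a ∈ HomogeneousIdeal.irrelevant 𝒜, ∀ y : (P.X i).carrier, a • y ∈ P.augSub i :=
  fun a ha y => Submodule.subset_span ⟨a, ha, y, rfl⟩

/-- A cycle modulo `A_{≥ 1}`, expressed in `X_i`. -/
def IsCyc (P : GradedProjectiveResolution 𝒜) : ∀ i, (P.X i).carrier → Prop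
  | 0, _ => True
  | i + 1, x => P.d i x ∈ P.augSub i

lemma subsingleton_tor_iff (P : GradedProjectiveResolution 𝒜) (i : ℕ) (n : ℤ) :
    Subsingleton (P.Tor i n) ↔ ∀ x ∈ (P.X i).deg n, P.IsCyc i x →
      ∃ y ∈ (P.X (i + 1)).deg n, x - P.d i y ∈ P.augSub i := by
  rw [QuotientAddGroup.subsingleton_iff, AddSubgroup.addSubgroupOf_eq_top]
  have key : ∀ x, P.IsCyc i x ↔ (P.augSub i).mkQ x ∈ P.coinvCycles i := by
    intro x
    cases i with
    | zero => simp [IsCyc, coinvCycles]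
    | succ i =>
      change _ ↔ P.coinvD i ((P.augSub (i + 1)).mkQ x) = 0
      simp [IsCyc, coinvD, Submodule.Quotient.mk_eq_zero]
  constructor
  · intro h x hx hc
    obtain ⟨_, ⟨y, hy, rfl⟩, hxy⟩ := h ⟨(key x).1 hc, ⟨x, hx, rfl⟩⟩
    refine ⟨y, hy, ?_⟩
    have : (P.augSub i).mkQ (P.d i y) = (P.augSub i).mkQ x := hxy
    rw [← (P.augSub i).ker_mkQ, LinearMap.mem_ker, map_sub, this, sub_self]
  · rintro h _ ⟨hc, x, hx, rfl⟩
    obtain ⟨y, hy, hxy⟩ := h x hx ((key x).2 hc)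
    refine ⟨_, ⟨y, hy, rfl⟩, ?_⟩
    change (P.augSub i).mkQ (P.d i y) = (P.augSub i).mkQ x
    rw [← (P.augSub i).ker_mkQ, LinearMap.mem_ker, map_sub, sub_eq_zero] at hxy
    exact hxy.symm

/-- Whether a graded piece of `Tor` vanishes does not depend on the resolution. -/
theorem subsingleton_tor_of (P Q : GradedProjectiveResolution 𝒜) (i : ℕ) (n : ℤ)
    (hP : Subsingleton (P.Tor i n)) : Subsingleton (Q.Tor i n) := by
  rw [subsingleton_tor_iff] at hP ⊢
  obtain ⟨f, hf, hf0, hfd⟩ := exists_comparison P Q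
  obtain ⟨g, hg, hg0, hgd⟩ := exists_comparison Q P
  obtain ⟨h, hh, hh0, hhd⟩ := exists_homotopy Q
    (fun i => LinearMap.id - (f i).comp (g i))
    (fun i n x hx => AddSubgroup.sub_mem _ hx (hf _ _ _ (hg _ _ _ hx)))
    (fun x => by simp [hf0, hg0]) (fun i x => by simp [hfd, hgd])
  intro x hx hc
  have hgc : P.IsCyc i (g i x) := by
    cases i with
    | zero => trivial
    | succ i =>
      change P.d i (g (i + 1) x) ∈ _
      rw [hgd]
      exact Q.map_augSub _ (g i) (P.smul_mem_augSub i) hc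
  obtain ⟨y, hy, hxy⟩ := hP _ (hg _ _ _ hx) hgc
  refine ⟨f (i + 1) y + h i x, AddSubgroup.add_mem _ (hf _ _ _ hy) (hh _ _ _ hx), ?_⟩
  have h1 : f i (g i x - P.d i y) ∈ Q.augSub i := P.map_augSub _ (f i) (Q.smul_mem_augSub i) hxy
  cases i with
  | zero =>
    have h2 := hh0 x
    simp only [LinearMap.sub_apply, LinearMap.id_apply, LinearMap.comp_apply] at h2
    convert h1 using 1
    rw [map_add, map_sub, hfd, ← h2]
    abel
  | succ i =>
    have h2 := hhd i x
    simp only [LinearMap.sub_apply, LinearMap.id_apply, LinearMap.comp_apply] at h2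
    have h3 : h i (Q.d i x) ∈ Q.augSub (i + 1) :=
      Q.map_augSub _ (h i) (Q.smul_mem_augSub (i + 1)) hc
    convert add_mem h1 h3 using 1
    rw [map_add, map_sub, hfd, eq_sub_of_add_eq h2.symm]
    abel

end GradedProjectiveResolution

/-- The Koszul property may be checked on any one graded projective resolution of `k`. -/
theorem isGeneralizedKoszul_iff {k : Type v} {A : Type u} [Field k] [Ring A] [Algebra k A]
    {𝒜 : ℕ → Submodule k A} [GradedAlgebra 𝒜] (P : GradedProjectiveResolution 𝒜) (N : ℕ) :
    IsGeneralizedKoszul 𝒜 N ↔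
      ∀ i, 3 ≤ i → ∀ n : ℤ, n ≠ jumpMap N i → Subsingleton (P.Tor i n) :=
  ⟨fun ⟨Q, hQ⟩ i hi n hn => Q.subsingleton_tor_of P i n (hQ i hi n hn), fun h => ⟨P, h⟩⟩

/-! The proof reads the degrees of the generators off the minimal graded free resolution of `k`,
whose terms are `A`, then a free module on a basis of `A_1`, then a free module on minimal
relations, and so on. Graded Nakayama supplies minimal generators (`exists_minimalGenerators`) and
shows that a projective syzygy is already equal to its minimal cover (`subsingleton_syzygy`), so the
resolution stops at step `D`.

Dimension shifting turns `Ext^D(k, A) ≅ k` into a statement on maps to `A` from the last syzygy `K`: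
modulo the maps that extend to the preceding free module, they form a line. Extendable maps send
minimal generators of `K` into `A_{≥1}`, while maps from the free module `K` take arbitrary values
on generators. Hence `K` has exactly one generator `u`, and every `a ∈ A_{≥1}` is the value at `u`
of an extendable map: the coefficients of `u` generate `A_{≥1}` as a right ideal
(`exists_unique_generator_of_ext`).

For `D = 2`, `u` is the only relation. Its coefficients have a common degree and generate `A_{≥1}`,
so they have degree `1` and `u` has degree `2`.

For `D = 3`, `Ext^2(k, A) = 0` shows moreover that the coefficients of `u` are minimal right
generators (`mem_irrelevant_of_extension`). As `A` is generated by `A_1`, they all have degree `1`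
(`degree_eq_add_one`). So all minimal relations share one degree `N`, and `u` has degree `N + 1 =
n(3)`.

Relations concentrated in degree `N` give the presentation of `A` (`TensorAlgebra.ker_eq_span`), and
the generator degrees of the minimal resolution bound those of `Tor`
(`isGeneralizedKoszul_of_degree`). -/

lemma DirectSum.isInternal_of_projections {ι M : Type*} [DecidableEq ι] [AddCommGroup M]
    (deg : ι → AddSubgroup M) (pr : ι → M →+ M) (h₁ : ∀ n, ∀ x ∈ deg n, pr n x = x)
    (h₂ : ∀ m n, m ≠ n → ∀ x ∈ deg m, pr n x = 0) (h₃ : ∀ x, x ∈ ⨆ n, deg n) :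
    DirectSum.IsInternal deg := by
  have hpr : ∀ n x, pr n (DirectSum.coeAddMonoidHom deg x) = x n := by
    intro n x
    induction x using DirectSum.induction_on with
    | zero => simp
    | of m x =>
      rw [DirectSum.coeAddMonoidHom_of]
      by_cases h : m = n
      · subst h
        rw [h₁ _ _ x.2, DirectSum.of_eq_same]
      · rw [h₂ _ _ h _ x.2, DirectSum.of_eq_of_ne _ _ _ (Ne.symm h), ZeroMemClass.coe_zero]
    | add x y hx hy => simp [hx, hy]
  constructor
  · rw [injective_iff_map_eq_zero]
    intro x hx
    ext n
    rw [← hpr, hx, map_zero]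
    rfl
  · intro x
    have : ⨆ n, deg n ≤ (DirectSum.coeAddMonoidHom deg).range :=
      iSup_le fun n y hy => ⟨DirectSum.of (fun i => ↥(deg i)) n ⟨y, hy⟩, by simp⟩
    exact this (h₃ x)

/-! ### Graded submodules, the regular module and graded free modules -/

namespace GradedLeftModule

section

variable {k : Type v} {A : Type u} [Field k] [Ring A] [Algebra k A] {𝒜 : ℕ → Submodule k A}

lemma mem_of_forall_pr_mem (M : GradedLeftModule 𝒜) (S : AddSubgroup M.carrier) {x : M.carrier}
    (h : ∀ n, M.pr n x ∈ S) : x ∈ S := by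
  classical
  let := M.isInternal.chooseDecomposition
  rw [← DirectSum.sum_support_decompose M.deg x]
  exact sum_mem fun n _ => h n

/-- A graded submodule, as a graded module. -/
abbrev ofSubmodule (M : GradedLeftModule 𝒜) (L : Submodule A M.carrier)
    (hL : ∀ n, ∀ x ∈ L, M.pr n x ∈ L) : GradedLeftModule 𝒜 where
  carrier := L
  deg n := (M.deg n).comap L.subtype.toAddMonoidHom
  isInternal := by
    let p : ℤ → L →+ L := fun n =>
      { toFun := fun x => ⟨M.pr n x, hL n x x.2⟩
        map_zero' := by ext; simp
        map_add' := fun x y => by ext; simp }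
    refine DirectSum.isInternal_of_projections _ p (fun n x hx => Subtype.ext (M.pr_of_mem hx))
      (fun m n h x hx => Subtype.ext (M.pr_of_mem_ne hx h)) fun x => ?_
    have h : ∀ n, p n x ∈ ⨆ n, (M.deg n).comap L.subtype.toAddMonoidHom := fun n =>
      AddSubgroup.mem_iSup_of_mem n (M.pr_mem n x)
    obtain ⟨y, hy, hyx⟩ := M.mem_of_forall_pr_mem (AddSubgroup.map L.subtype.toAddMonoidHom
      (⨆ n, (M.deg n).comap L.subtype.toAddMonoidHom)) fun n => ⟨p n x, h n, rfl⟩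
    rwa [← show y = x from Subtype.ext hyx]
  smul_mem ha hx := M.smul_mem ha hx

/-- A graded module whose homogeneous components vanish in all degrees below some bound. -/
def BoundedBelow (M : GradedLeftModule 𝒜) : Prop :=
  ∃ b : ℤ, ∀ n < b, ∀ x ∈ M.deg n, x = 0

lemma BoundedBelow.ofSubmodule {M : GradedLeftModule 𝒜} (hM : M.BoundedBelow)
    (L : Submodule A M.carrier) (hL : ∀ n, ∀ x ∈ L, M.pr n x ∈ L) :
    (M.ofSubmodule L hL).BoundedBelow := by
  obtain ⟨b, hb⟩ := hM
  exact ⟨b, fun n hn x hx => Subtype.ext (hb n hn x.1 hx)⟩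

end

variable {k : Type v} {A : Type u} [Field k] [Ring A] [Algebra k A] (𝒜 : ℕ → Submodule k A)
  [GradedAlgebra 𝒜]

/-- The component of `A` of degree `z`, for an integer `z`. -/
def intComponent (z : ℤ) : AddSubgroup A where
  carrier := {a | ∀ m : ℕ, (m : ℤ) ≠ z → GradedRing.proj 𝒜 m a = 0}
  zero_mem' := by simp
  add_mem' ha hb m hm := by rw [map_add, ha m hm, hb m hm, add_zero]
  neg_mem' ha m hm := by rw [map_neg, ha m hm, neg_zero]

lemma mem_intComponent_natCast {n : ℕ} {a : A} : a ∈ intComponent 𝒜 n ↔ a ∈ 𝒜 n := by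
  classical
  constructor
  · intro h
    rw [← DirectSum.sum_support_decompose 𝒜 a]
    refine sum_mem fun m _ => ?_
    by_cases hm : m = n
    · subst hm
      exact (DirectSum.decompose 𝒜 a m).2
    · have := h m (by exact_mod_cast hm)
      rw [GradedRing.proj_apply] at this
      rw [this]
      exact zero_mem _
  · intro h m hm
    rw [GradedRing.proj_apply, DirectSum.decompose_of_mem_ne 𝒜 h (by exact_mod_cast hm.symm)]

lemma eq_zero_or_mem_of_mem_intComponent {z : ℤ} {a : A} (h : a ∈ intComponent 𝒜 z) :
    a = 0 ∨ ∃ n : ℕ, z = n ∧ a ∈ 𝒜 n := by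
  classical
  by_cases hz : 0 ≤ z
  · lift z to ℕ using hz
    exact Or.inr ⟨z, rfl, (mem_intComponent_natCast 𝒜).1 h⟩
  · left
    rw [← DirectSum.sum_support_decompose 𝒜 a]
    refine Finset.sum_eq_zero fun m _ => ?_
    simpa only [GradedRing.proj_apply] using h m (by omega)

/-- The projection of `A` onto its component of degree `z`, for an integer `z`. -/
def intProj (z : ℤ) : A →+ A := if 0 ≤ z then GradedRing.proj 𝒜 z.toNat else 0

lemma intProj_of_mem {z : ℤ} {a : A} (h : a ∈ intComponent 𝒜 z) : intProj 𝒜 z a = a := by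
  rcases eq_zero_or_mem_of_mem_intComponent 𝒜 h with rfl | ⟨n, rfl, hn⟩
  · exact map_zero _
  · simpa [intProj, GradedRing.proj_apply] using DirectSum.decompose_of_mem_same 𝒜 hn

lemma intProj_of_mem_ne {y z : ℤ} {a : A} (h : a ∈ intComponent 𝒜 y) (hyz : y ≠ z) :
    intProj 𝒜 z a = 0 := by
  unfold intProj
  split_ifs with hz
  · exact h _ (by omega)
  · rfl

lemma intComponent_induction (S : AddSubgroup A) (h : ∀ z, ∀ a ∈ intComponent 𝒜 z, a ∈ S)
    (a : A) : a ∈ S := by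
  induction a using DirectSum.Decomposition.inductionOn 𝒜 with
  | zero => exact zero_mem _
  | @homogeneous n a => exact h n _ ((mem_intComponent_natCast 𝒜).2 a.2)
  | add a b ha hb => exact add_mem ha hb

lemma mul_mem_intComponent {m : ℕ} {n : ℤ} {a b : A} (ha : a ∈ 𝒜 m)
    (hb : b ∈ intComponent 𝒜 n) : a * b ∈ intComponent 𝒜 (m + n) := by
  rcases eq_zero_or_mem_of_mem_intComponent 𝒜 hb with rfl | ⟨j, rfl, hj⟩
  · rw [mul_zero]
    exact zero_mem _
  · exact_mod_cast (mem_intComponent_natCast 𝒜).2 (SetLike.mul_mem_graded ha hj)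

lemma isInternal_intComponent : DirectSum.IsInternal (intComponent 𝒜) :=
  DirectSum.isInternal_of_projections _ (intProj 𝒜) (fun _ _ => intProj_of_mem 𝒜)
    (fun _ _ h _ hx => intProj_of_mem_ne 𝒜 hx h)
    (intComponent_induction 𝒜 _ fun z _ ha => AddSubgroup.mem_iSup_of_mem z ha)

/-- The algebra `A` as a graded left module over itself. -/
abbrev regular : GradedLeftModule 𝒜 where
  carrier := A
  deg := intComponent 𝒜
  isInternal := isInternal_intComponent 𝒜
  smul_mem := mul_mem_intComponent 𝒜

lemma regular_boundedBelow : (regular 𝒜).BoundedBelow := by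
  refine ⟨0, fun n hn x hx => ?_⟩
  rcases eq_zero_or_mem_of_mem_intComponent 𝒜 hx with rfl | ⟨j, rfl, hj⟩
  · rfl
  · omega

/-- The elements of degree `n` of the free module with a basis of elements of degrees `δ i`. -/
def freeComponent {ι : Type u} (δ : ι → ℤ) (n : ℤ) : AddSubgroup (ι →₀ A) where
  carrier := {f | ∀ i, f i ∈ intComponent 𝒜 (n - δ i)}
  zero_mem' := fun _ => zero_mem _
  add_mem' := fun hf hg i => add_mem (hf i) (hg i)
  neg_mem' := fun hf i => neg_mem (hf i)

lemma single_mem_freeComponent {ι : Type u} (δ : ι → ℤ) {n : ℤ} {i : ι} {a : A}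
    (h : a ∈ intComponent 𝒜 (n - δ i)) : Finsupp.single i a ∈ freeComponent 𝒜 δ n := by
  intro j
  by_cases hj : i = j
  · subst hj
    rwa [Finsupp.single_eq_same]
  · rw [Finsupp.single_eq_of_ne' hj]
    exact zero_mem _

lemma isInternal_freeComponent {ι : Type u} (δ : ι → ℤ) :
    DirectSum.IsInternal (freeComponent 𝒜 δ) := by
  refine DirectSum.isInternal_of_projections _
    (fun n => Finsupp.liftAddHom fun i =>
      (Finsupp.singleAddHom i).comp (intProj 𝒜 (n - δ i))) ?_ ?_ ?_
  · intro n f hf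
    conv_rhs => rw [← Finsupp.sum_single f]
    exact Finsupp.sum_congr fun i _ =>
      congrArg (Finsupp.single i) (intProj_of_mem 𝒜 (hf i))
  · intro m n h f hf
    refine Finset.sum_eq_zero fun i _ => ?_
    change Finsupp.single i (intProj 𝒜 (n - δ i) (f i)) = 0
    rw [intProj_of_mem_ne 𝒜 (hf i) (by omega), Finsupp.single_zero]
  · intro f
    induction f using Finsupp.induction_linear with
    | zero => exact zero_mem _
    | add f g hf hg => exact add_mem hf hg
    | single i a =>
      refine intComponent_induction 𝒜
        ((⨆ n, freeComponent 𝒜 δ n).comap (Finsupp.singleAddHom i)) (fun z a ha => ?_) a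
      refine AddSubgroup.mem_iSup_of_mem (z + δ i) (single_mem_freeComponent 𝒜 δ ?_)
      rwa [add_sub_cancel_right]

/-- The free graded module with a basis of elements of degrees `δ i`. -/
noncomputable abbrev free {ι : Type u} (δ : ι → ℤ) : GradedLeftModule 𝒜 where
  carrier := ι →₀ A
  deg := freeComponent 𝒜 δ
  isInternal := isInternal_freeComponent 𝒜 δ
  smul_mem {m n a x} ha hx i := by
    rw [Finsupp.smul_apply, add_sub_assoc]
    exact mul_mem_intComponent 𝒜 ha (hx i)

variable {𝒜}

lemma free_boundedBelow {ι : Type u} {δ : ι → ℤ} (h : ∃ b, ∀ i, b ≤ δ i) :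
    (free 𝒜 δ).BoundedBelow := by
  obtain ⟨b, hb⟩ := h
  refine ⟨b, fun n hn x hx => Finsupp.ext fun i => ?_⟩
  rcases eq_zero_or_mem_of_mem_intComponent 𝒜 (hx i) with h | ⟨j, hj, -⟩
  · exact h
  · have := hb i
    omega

/-! ### Graded Nakayama lemma and minimal generators -/

/-- The submodule `A_{≥ 1} M`. -/
def aug (M : GradedLeftModule 𝒜) : Submodule A M.carrier :=
  Submodule.span A {y | ∃ a ∈ HomogeneousIdeal.irrelevant 𝒜, ∃ x : M.carrier, a • x = y}

lemma smul_mem_aug (M : GradedLeftModule 𝒜) {a : A} (ha : a ∈ HomogeneousIdeal.irrelevant 𝒜)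
    (x : M.carrier) : a • x ∈ M.aug :=
  Submodule.subset_span ⟨a, ha, x, rfl⟩

lemma mem_of_mem_irrelevant (S : AddSubgroup A) (h : ∀ i > 0, ∀ a ∈ 𝒜 i, a ∈ S) {a : A}
    (ha : a ∈ HomogeneousIdeal.irrelevant 𝒜) : a ∈ S :=
  (HomogeneousIdeal.toAddSubmonoid_irrelevant_le 𝒜 (P := S.toAddSubmonoid)).2
    (fun i hi a ha => h i hi a ha) ha

lemma mem_of_mem_aug {M : GradedLeftModule 𝒜} (S : AddSubgroup M.carrier)
    (h : ∀ i > 0, ∀ a ∈ 𝒜 i, ∀ x : M.carrier, a • x ∈ S) {y : M.carrier} (hy : y ∈ M.aug) :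
    y ∈ S := by
  -- `S` is only an additive subgroup; it is replaced by the largest `A`-submodule that it contains.
  let S' : Submodule A M.carrier :=
    { carrier := {y | ∀ c : A, c • y ∈ S}
      zero_mem' := fun c => by rw [smul_zero]; exact zero_mem _
      add_mem' := fun hx hy c => by rw [smul_add]; exact add_mem (hx c) (hy c)
      smul_mem' := fun a x hx c => by rw [smul_smul]; exact hx _ }
  have hS : M.aug ≤ S' := by
    refine Submodule.span_le.2 ?_
    rintro _ ⟨a, ha, x, rfl⟩ c
    rw [smul_smul]
    exact mem_of_mem_irrelevant (S.comap ((smulAddHom A M.carrier).flip x))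
      (fun i hi a ha => h i hi a ha x) (Ideal.mul_mem_left _ c ha)
  simpa using hS hy 1

/-- The graded Nakayama lemma. -/
theorem eq_top_of_sup_aug_eq_top {M : GradedLeftModule 𝒜} (hM : M.BoundedBelow)
    (L : Submodule A M.carrier) (hL : ∀ n, ∀ x ∈ L, M.pr n x ∈ L) (h : L ⊔ M.aug = ⊤) : L = ⊤ := by
  obtain ⟨b, hb⟩ := hM
  -- Induction on the degree, starting below `b` where `M` vanishes: the degree `n` part of `a • x`,
  -- with `a` of degree `i > 0`, is `a` times a component of `x` of degree `n - i < n`.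
  have key : ∀ j : ℕ, ∀ n < b + j, ∀ x, M.pr n x ∈ L := by
    intro j
    induction j with
    | zero =>
      intro n hn x
      rw [hb n (by simpa using hn) _ (M.pr_mem n x)]
      exact zero_mem _
    | succ j ih =>
      intro n hn x
      obtain ⟨y, hy, z, hz, rfl⟩ := Submodule.mem_sup.1 (h ▸ Submodule.mem_top : x ∈ L ⊔ M.aug)
      rw [map_add]
      refine add_mem (hL _ _ hy) (mem_of_mem_aug (L.toAddSubgroup.comap (M.pr n)) ?_ hz)
      intro i hi a ha x
      have := M.pr_smul ha (n - i) x
      rw [add_sub_cancel] at this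
      rw [AddSubgroup.mem_comap, this]
      exact L.smul_mem _ (ih _ (by push_cast at hn; omega) _)
  refine Submodule.eq_top_iff'.2 fun x => M.mem_of_forall_pr_mem L.toAddSubgroup fun n => ?_
  exact key (n - b + 1).toNat n (by omega) x

/-- A minimal system of homogeneous generators of a graded module. -/
structure MinimalGenerators (M : GradedLeftModule 𝒜) where
  ι : Type u
  δ : ι → ℤ
  gen : ι → M.carrier
  gen_mem : ∀ i, gen i ∈ M.deg (δ i)
  span_eq_top : Submodule.span A (Set.range gen) = ⊤
  minimal : ∀ f : ι →₀ A, Finsupp.linearCombination A gen f = 0 →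
    ∀ i, f i ∈ HomogeneousIdeal.irrelevant 𝒜

lemma one_notMem_irrelevant [Nontrivial A] : (1 : A) ∉ HomogeneousIdeal.irrelevant 𝒜 := by
  rw [HomogeneousIdeal.mem_irrelevant_iff, GradedRing.proj_apply,
    DirectSum.decompose_of_mem_same 𝒜 SetLike.GradedOne.one_mem]
  exact one_ne_zero

/-- `A_{≥1}` is introduced as a left ideal; it is two-sided because it is the kernel of the ring
homomorphism `A → A_0 ⊆ A`. -/
lemma mul_mem_irrelevant {a : A} (ha : a ∈ HomogeneousIdeal.irrelevant 𝒜) (b : A) :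
    a * b ∈ HomogeneousIdeal.irrelevant 𝒜 := by
  have h : ∀ a, a ∈ HomogeneousIdeal.irrelevant 𝒜 ↔ GradedRing.projZeroRingHom 𝒜 a = 0 :=
    fun a => Iff.rfl
  rw [h] at ha ⊢
  rw [map_mul, ha, zero_mul]

namespace MinimalGenerators

variable {M : GradedLeftModule 𝒜} (G : M.MinimalGenerators)

/-- The free module on the generators. -/
noncomputable abbrev cover : GradedLeftModule 𝒜 := free 𝒜 G.δ

/-- The projection of the free module onto `M`. -/
noncomputable abbrev proj : G.cover.carrier →ₗ[A] M.carrier := Finsupp.linearCombination A G.gen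

lemma proj_mem (n : ℤ) (x : G.cover.carrier) (hx : x ∈ G.cover.deg n) : G.proj x ∈ M.deg n := by
  rw [proj, Finsupp.linearCombination_apply]
  refine sum_mem fun i _ => ?_
  dsimp only
  rcases eq_zero_or_mem_of_mem_intComponent 𝒜 (hx i) with h | ⟨j, hj, hm⟩
  · rw [h, zero_smul]
    exact zero_mem _
  · have := M.smul_mem hm (G.gen_mem i)
    rwa [← hj, sub_add_cancel] at this

lemma proj_surjective : Function.Surjective G.proj := by
  rw [← LinearMap.range_eq_top, proj, Finsupp.range_linearCombination, G.span_eq_top]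

/-- The kernel of the projection. -/
noncomputable abbrev syzygy : GradedLeftModule 𝒜 :=
  G.cover.ofSubmodule (LinearMap.ker G.proj) fun n x hx => by
    rw [LinearMap.mem_ker, map_pr G.proj G.proj_mem, hx, map_zero]

lemma gen_ne_zero [Nontrivial A] (i : G.ι) : G.gen i ≠ 0 := by
  intro h
  have := G.minimal (Finsupp.single i 1) (by simp [h]) i
  rw [Finsupp.single_eq_same] at this
  exact one_notMem_irrelevant this

lemma cover_boundedBelow [Nontrivial A] (hM : M.BoundedBelow) : G.cover.BoundedBelow := by
  obtain ⟨b, hb⟩ := hM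
  refine free_boundedBelow ⟨b, fun i => ?_⟩
  by_contra! h
  exact G.gen_ne_zero i (hb _ h _ (G.gen_mem i))

lemma syzygy_boundedBelow [Nontrivial A] (hM : M.BoundedBelow) : G.syzygy.BoundedBelow :=
  (G.cover_boundedBelow hM).ofSubmodule _ _

lemma coeff_mem (x : G.syzygy.carrier) (i : G.ι) : x.1 i ∈ HomogeneousIdeal.irrelevant 𝒜 :=
  G.minimal x.1 x.2 i

/-- The syzygies of a projective module with respect to a minimal system of generators are
trivial. -/
theorem subsingleton_syzygy [Nontrivial A] (hM : M.BoundedBelow)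
    (hP : Module.Projective A M.carrier) : Subsingleton G.syzygy.carrier := by
  obtain ⟨s, hs⟩ := Module.projective_lifting_property G.proj LinearMap.id G.proj_surjective
  have hs' : ∀ x, G.proj (s x) = x := fun x => LinearMap.congr_fun hs x
  -- A splitting of the cover gives a retraction `q` onto the syzygies. For a syzygy `x`, `x = q x =
  -- ∑ x_i q(e_i)` with all `x_i ∈ A_{≥1}` by minimality, so the syzygy module equals its product
  -- with `A_{≥1}` and Nakayama kills it.
  let q : G.cover.carrier →ₗ[A] G.syzygy.carrier :=
    (LinearMap.id - s.comp G.proj).codRestrict (LinearMap.ker G.proj) fun x => by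
      simp [hs']
  have hq : ∀ x : G.syzygy.carrier, q x.1 = x := fun x => by
    apply Subtype.ext
    change x.1 - s (G.proj x.1) = x.1
    rw [show G.proj x.1 = 0 from x.2, map_zero, sub_zero]
  have htop : G.syzygy.aug = ⊤ := by
    refine Submodule.eq_top_iff'.2 fun x => ?_
    rw [← hq x, ← Finsupp.sum_single x.1, Finsupp.sum, map_sum]
    refine sum_mem fun i _ => ?_
    rw [← mul_one (x.1 i), ← smul_eq_mul, ← Finsupp.smul_single, map_smul]
    exact smul_mem_aug _ (G.coeff_mem x i) _
  have := eq_top_of_sup_aug_eq_top (G.syzygy_boundedBelow hM) ⊥ (fun n x hx => by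
    rw [(Submodule.mem_bot A).1 hx, map_zero]
    exact zero_mem _) (by rw [bot_sup_eq, htop])
  exact (Submodule.subsingleton_iff A).1 (subsingleton_of_bot_eq_top this)

end MinimalGenerators

lemma pr_mem_span {M : GradedLeftModule 𝒜} {ι : Type*} {δ : ι → ℤ} {g : ι → M.carrier}
    (hg : ∀ i, g i ∈ M.deg (δ i)) (n : ℤ) (x : M.carrier)
    (hx : x ∈ Submodule.span A (Set.range g)) : M.pr n x ∈ Submodule.span A (Set.range g) := by
  induction hx using Submodule.span_induction generalizing n with
  | mem x hx =>
    obtain ⟨i, rfl⟩ := hx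
    by_cases h : δ i = n
    · subst h
      rw [M.pr_of_mem (hg i)]
      exact Submodule.subset_span ⟨i, rfl⟩
    · rw [M.pr_of_mem_ne (hg i) h]
      exact zero_mem _
  | zero =>
    rw [map_zero]
    exact zero_mem _
  | add x y _ _ hx hy =>
    rw [map_add]
    exact add_mem (hx n) (hy n)
  | smul a x _ hx =>
    induction a using DirectSum.Decomposition.inductionOn 𝒜 with
    | zero =>
      rw [zero_smul, map_zero]
      exact zero_mem _
    | @homogeneous m a =>
      have := M.pr_smul a.2 (n - m) x
      rw [add_sub_cancel] at this
      rw [this]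
      exact Submodule.smul_mem _ _ (hx _)
    | add a b ha hb =>
      rw [add_smul, map_add]
      exact add_mem ha hb

lemma exists_algebraMap_sub_mem (h : 𝒜 0 = LinearMap.range (Algebra.linearMap k A)) (a : A) :
    ∃ c : k, a - algebraMap k A c ∈ HomogeneousIdeal.irrelevant 𝒜 := by
  have h0 : GradedRing.proj 𝒜 0 a ∈ 𝒜 0 := (DirectSum.decompose 𝒜 a 0).2
  obtain ⟨c, hc⟩ := (h ▸ h0 : _ ∈ LinearMap.range (Algebra.linearMap k A))
  refine ⟨c, ?_⟩
  have hc' : algebraMap k A c ∈ 𝒜 0 := h ▸ ⟨c, rfl⟩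
  rw [HomogeneousIdeal.mem_irrelevant_iff, map_sub, sub_eq_zero,
    GradedRing.proj_apply 𝒜 0 (algebraMap k A c), DirectSum.decompose_of_mem_same 𝒜 hc', ← hc]
  rfl

/-- A graded module over a connected graded algebra that is bounded below has a minimal system of
homogeneous generators. -/
theorem exists_minimalGenerators (h : 𝒜 0 = LinearMap.range (Algebra.linearMap k A))
    (M : GradedLeftModule 𝒜) (hM : M.BoundedBelow) : Nonempty M.MinimalGenerators := by
  let W := M.carrier ⧸ M.aug
  let : Module k W := Module.compHom W (algebraMap k A)
  have hsmul : ∀ (c : k) (w : W), c • w = algebraMap k A c • w := fun _ _ => rfl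
  have key : ∀ (a : A) (c : k), a - algebraMap k A c ∈ HomogeneousIdeal.irrelevant 𝒜 →
      ∀ w : W, a • w = c • w := by
    intro a c hc w
    obtain ⟨x, rfl⟩ := M.aug.mkQ_surjective w
    rw [hsmul, ← sub_eq_zero, ← sub_smul, ← map_smul, ← LinearMap.mem_ker, Submodule.ker_mkQ]
    exact M.smul_mem_aug hc x
  let H := {p : ℤ × M.carrier // p.2 ∈ M.deg p.1}
  -- The generators lift a `k`-basis of `M / A_{≥1} M` extracted from the classes of homogeneous
  -- elements. Each element is indexed together with a degree, since `0` has no degree of its own.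
  obtain ⟨κ, a, -, hsp, hli⟩ := exists_linearIndependent' k (fun p : H => M.aug.mkQ p.1.2)
  let g : κ → M.carrier := fun i => (a i).1.2
  have hg : ∀ i, g i ∈ M.deg (a i).1.1 := fun i => (a i).2
  have hspan : ∀ w : W, ∃ y ∈ Submodule.span A (Set.range g), M.aug.mkQ y = w := by
    intro w
    have hw : w ∈ Submodule.span k (Set.range fun p : H => M.aug.mkQ p.1.2) := by
      obtain ⟨x, rfl⟩ := M.aug.mkQ_surjective w
      exact M.mem_of_forall_pr_mem
        ((Submodule.span k (Set.range fun p : H => M.aug.mkQ p.1.2)).toAddSubgroup.comap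
          M.aug.mkQ.toAddMonoidHom)
        fun n => Submodule.subset_span ⟨⟨(n, M.pr n x), M.pr_mem n x⟩, rfl⟩
    rw [← hsp] at hw
    induction hw using Submodule.span_induction with
    | mem w hw =>
      obtain ⟨i, rfl⟩ := hw
      exact ⟨g i, Submodule.subset_span ⟨i, rfl⟩, rfl⟩
    | zero => exact ⟨0, zero_mem _, map_zero _⟩
    | add v w _ _ hv hw =>
      obtain ⟨y, hy, rfl⟩ := hv
      obtain ⟨z, hz, rfl⟩ := hw
      exact ⟨y + z, add_mem hy hz, map_add _ _ _⟩
    | smul c w _ hw =>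
      obtain ⟨y, hy, rfl⟩ := hw
      exact ⟨algebraMap k A c • y, Submodule.smul_mem _ _ hy, map_smul _ _ _⟩
  refine ⟨{ ι := κ, δ := fun i => (a i).1.1, gen := g, gen_mem := hg, span_eq_top := ?_,
            minimal := ?_ }⟩
  · refine eq_top_of_sup_aug_eq_top hM _ (pr_mem_span hg) (Submodule.eq_top_iff'.2 fun x => ?_)
    obtain ⟨y, hy, hyx⟩ := hspan (M.aug.mkQ x)
    rw [← sub_add_cancel x y, add_comm]
    refine Submodule.add_mem_sup hy ?_
    rw [← Submodule.ker_mkQ M.aug, LinearMap.mem_ker, map_sub, hyx, sub_self]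
  -- `A` acts on `M / A_{≥1} M` through `A / A_{≥1} = k`, so a relation reduces to a `k`-linear
  -- relation between basis vectors and its constant terms vanish.
  · intro f hf i
    choose c hc using fun i => exists_algebraMap_sub_mem h (f i)
    by_cases hi : i ∈ f.support
    · have h0 : ∑ i ∈ f.support, c i • M.aug.mkQ (g i) = 0 := by
        rw [← map_zero M.aug.mkQ, ← hf, Finsupp.linearCombination_apply, Finsupp.sum, map_sum]
        exact Finset.sum_congr rfl fun i _ => by rw [map_smul, key _ _ (hc i)]
      have := hc i
      rwa [linearIndependent_iff'.1 hli f.support c h0 i hi, map_zero, sub_zero] at this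
    · rw [Finsupp.notMem_support_iff.1 hi]
      exact zero_mem _

end GradedLeftModule

/-! ### Dimension shifting and extension of maps -/

section

variable {k : Type v} {A : Type u} [Field k] [Ring A] [Algebra k A]

/-- The short exact sequence `0 → ker π → F → M → 0`. -/
abbrev LinearMap.kerShortComplex {F M : Type u} [AddCommGroup F] [Module A F] [AddCommGroup M]
    [Module A M] (π : F →ₗ[A] M) : ShortComplex (ModuleCat.{u} A) :=
  ShortComplex.mk (ModuleCat.ofHom (LinearMap.ker π).subtype) (ModuleCat.ofHom π)
    (by ext x; exact x.2)

variable {F M : Type u} [AddCommGroup F] [Module A F] [AddCommGroup M] [Module A M]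
  {π : F →ₗ[A] M}

lemma LinearMap.kerShortComplex_shortExact (hπ : Function.Surjective π) :
    π.kerShortComplex.ShortExact := by
  refine ModuleCat.shortComplex_shortExact _ (fun x => ?_) Subtype.val_injective hπ
  exact ⟨fun h => ⟨⟨x, h⟩, rfl⟩, fun ⟨y, hy⟩ => hy ▸ y.2⟩

open Abelian

lemma LinearMap.projective_X₂ [Module.Projective A F] : Projective π.kerShortComplex.X₂ :=
  (IsProjective.iff_projective F).1 inferInstance

lemma LinearMap.ext_X₂_eq_zero [Module.Projective A F] {Y : ModuleCat.{u} A} {n : ℕ}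
    (x : Ext π.kerShortComplex.X₂ Y (n + 1)) : x = 0 := by
  have := π.projective_X₂
  exact Ext.eq_zero_of_projective x

lemma LinearMap.hasProjectiveDimensionLE_ker [Module.Projective A F] (hπ : Function.Surjective π)
    (n : ℕ) (h : HasProjectiveDimensionLE (ModuleCat.of A M) (n + 1)) :
    HasProjectiveDimensionLE (ModuleCat.of A (LinearMap.ker π)) n :=
  ((LinearMap.kerShortComplex_shortExact hπ).hasProjectiveDimensionLT_X₃_iff n
    π.projective_X₂).1 h

lemma ModuleCat.projective_of_hasProjectiveDimensionLE_zero
    (h : HasProjectiveDimensionLE (ModuleCat.of A M) 0) : Module.Projective A M :=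
  (IsProjective.iff_projective M).2 ((projective_iff_hasProjectiveDimensionLE_zero _).2 h)

/-- In the long exact sequence the neighbouring groups are `Ext(F, Y)` in degrees `n + 1` and `n +
2`; both degrees are positive, so both groups vanish. -/
lemma LinearMap.extClass_comp_bijective [Module.Projective A F] (hπ : Function.Surjective π)
    (Y : ModuleCat.{u} A) (n : ℕ) :
    Function.Bijective fun x : Ext (ModuleCat.of A (LinearMap.ker π)) Y (n + 1) =>
      (LinearMap.kerShortComplex_shortExact hπ).extClass.comp x
        (show 1 + (n + 1) = n + 2 by omega) := by
  have hS := LinearMap.kerShortComplex_shortExact hπ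
  constructor
  · intro x y hxy
    obtain ⟨z, hz⟩ := Ext.contravariant_sequence_exact₁ hS Y (x - y)
      (show 1 + (n + 1) = n + 2 by omega) ((map_sub (hS.extClass.precomp Y (show 1 + (n + 1) = n + 2 by omega)) x y).trans
        (sub_eq_zero.2 hxy))
    rw [π.ext_X₂_eq_zero z, Ext.comp_zero] at hz
    exact sub_eq_zero.1 hz.symm
  · intro y
    exact Ext.contravariant_sequence_exact₃ hS Y y (π.ext_X₂_eq_zero _) _

/-- Dimension shifting. -/
noncomputable def LinearMap.extKerEquiv [Module.Projective A F] (hπ : Function.Surjective π)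
    (Y : ModuleCat.{u} A) (n : ℕ) :
    Ext (ModuleCat.of A (LinearMap.ker π)) Y (n + 1) ≃ₗ[k] Ext (ModuleCat.of A M) Y (n + 2) :=
  LinearEquiv.ofBijective
    (Ext.bilinearCompOfLinear k _ _ _ 1 (n + 1) (n + 2) (by omega)
      (LinearMap.kerShortComplex_shortExact hπ).extClass)
    (LinearMap.extClass_comp_bijective hπ Y n)

/-- The product with the extension class is the connecting map `Hom(ker π, N) → Ext¹(M, N)`, so it
is the obstruction to extending `f` to `F`. -/
lemma LinearMap.exists_extension_iff (hπ : Function.Surjective π) {N : Type u} [AddCommGroup N]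
    [Module A N] (f : LinearMap.ker π →ₗ[A] N) :
    (LinearMap.kerShortComplex_shortExact hπ).extClass.comp
      (Ext.mk₀ (ModuleCat.ofHom f)) (add_zero 1) = 0 ↔
    ∃ g : F →ₗ[A] N, ∀ x : LinearMap.ker π, g x = f x := by
  have hS := LinearMap.kerShortComplex_shortExact hπ
  constructor
  · intro h
    obtain ⟨y, hy⟩ := Ext.contravariant_sequence_exact₁ hS _ _ _ h
    obtain ⟨g, rfl⟩ := (Ext.mk₀_bijective _ _).2 y
    rw [Ext.mk₀_comp_mk₀] at hy
    have := (Ext.mk₀_bijective _ _).1 hy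
    exact ⟨g.hom, fun x => congrArg (fun h => h.hom x) this⟩
  · rintro ⟨g, hg⟩
    have : ModuleCat.ofHom f = π.kerShortComplex.f ≫ ModuleCat.ofHom g := by
      ext x
      exact (hg x).symm
    rw [this, ← Ext.mk₀_comp_mk₀]
    exact hS.extClass_comp_assoc _

lemma LinearMap.exists_extension (hπ : Function.Surjective π) {N : Type u} [AddCommGroup N]
    [Module A N] (h : Subsingleton (Ext (ModuleCat.of A M) (ModuleCat.of A N) 1))
    (f : LinearMap.ker π →ₗ[A] N) :
    ∃ g : F →ₗ[A] N, ∀ x : LinearMap.ker π, g x = f x :=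
  (LinearMap.exists_extension_iff hπ f).1 (Subsingleton.elim _ _)

/-- When `Ext¹(M, N)` is one-dimensional, the maps `ker π → N` are spanned by a single one modulo
those that extend. -/
lemma LinearMap.exists_generator_modulo_extensions [Module.Projective A F]
    (hπ : Function.Surjective π)
    {N : Type u} [AddCommGroup N] [Module A N]
    (e : Ext (ModuleCat.of A M) (ModuleCat.of A N) 1 ≃ₗ[k] k) :
    ∃ f₀ : LinearMap.ker π →ₗ[A] N,
      (¬ ∃ g : F →ₗ[A] N, ∀ x : LinearMap.ker π, g x = f₀ x) ∧
      ∀ f : LinearMap.ker π →ₗ[A] N, ∃ c : k, ∃ g : F →ₗ[A] N,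
        ∀ x : LinearMap.ker π, g x = f x - algebraMap k A c • f₀ x := by
  have hS := LinearMap.kerShortComplex_shortExact hπ
  obtain ⟨y, hy⟩ := Ext.contravariant_sequence_exact₃ hS _ (e.symm 1) (π.ext_X₂_eq_zero (n := 0) _)
    (add_zero 1)
  obtain ⟨f₀, rfl⟩ := (Ext.mk₀_bijective _ _).2 y
  refine ⟨f₀.hom, ?_, fun f => ?_⟩
  · rw [← LinearMap.exists_extension_iff hπ, ModuleCat.ofHom_hom]
    intro h
    rw [hy] at h
    simp at h
  -- The connecting map sends `f₀` to the basis vector `e.symm 1`; the constant is the coordinate of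
  -- the obstruction `z` of `f`, so that `f - e z • f₀` has obstruction zero.
  · let z := hS.extClass.comp (Ext.mk₀ (ModuleCat.ofHom f)) (add_zero 1)
    refine ⟨e z, ?_⟩
    let L : (ModuleCat.of A (LinearMap.ker π) ⟶ ModuleCat.of A N) →ₗ[k]
        Ext (ModuleCat.of A M) (ModuleCat.of A N) 1 :=
      (Ext.bilinearCompOfLinear k _ _ _ 1 0 1 (by omega) hS.extClass).comp
        (Ext.linearEquiv₀ (R := k)).symm.toLinearMap
    have hL : L (ModuleCat.ofHom f - e z • f₀) = 0 := by
      rw [map_sub, map_smul, sub_eq_zero, show L f₀ = e.symm 1 from hy]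
      apply e.injective
      rw [map_smul, LinearEquiv.apply_symm_apply, smul_eq_mul, mul_one]
      rfl
    obtain ⟨g, hg⟩ := (LinearMap.exists_extension_iff hπ
      (ModuleCat.ofHom f - e z • f₀ : ModuleCat.of A (LinearMap.ker π) ⟶ _).hom).1 hL
    exact ⟨g, hg⟩

end

/-! ### Homogeneous two-sided ideals and graded surjections -/

section

variable {k T : Type*} [Field k] [Ring T] [Algebra k T] (𝒯 : ℕ → Submodule k T) [GradedAlgebra 𝒯]

/-- A two-sided ideal generated by homogeneous elements is homogeneous. -/
lemma TwoSidedIdeal.proj_mem_span {R : Set T} {N : ℕ} (hR : R ⊆ 𝒯 N) {x : T}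
    (hx : x ∈ TwoSidedIdeal.span R) (i : ℕ) : GradedRing.proj 𝒯 i x ∈ TwoSidedIdeal.span R := by
  let J := TwoSidedIdeal.span R
  -- The elements all of whose components lie in `J` form a two-sided ideal; it contains `R`, hence
  -- `J`.
  let J' : TwoSidedIdeal T := TwoSidedIdeal.mk' {x | ∀ i, GradedRing.proj 𝒯 i x ∈ J}
    (fun i => by rw [map_zero]; exact J.zero_mem)
    (fun hx hy i => by rw [map_add]; exact J.add_mem (hx i) (hy i))
    (fun hx i => by rw [map_neg]; exact J.neg_mem (hx i))
    (fun {x y} hy i => by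
      induction x using DirectSum.Decomposition.inductionOn 𝒯 with
      | zero => rw [zero_mul, map_zero]; exact J.zero_mem
      | @homogeneous m x =>
        rw [GradedRing.proj_apply, DirectSum.coe_decompose_mul_of_left_mem 𝒯 i x.2]
        split_ifs
        · exact J.mul_mem_left _ _ (hy _)
        · exact J.zero_mem
      | add a b ha hb => rw [add_mul, map_add]; exact J.add_mem ha hb)
    (fun {x y} hx i => by
      induction y using DirectSum.Decomposition.inductionOn 𝒯 with
      | zero => rw [mul_zero, map_zero]; exact J.zero_mem
      | @homogeneous m y =>
        rw [GradedRing.proj_apply, DirectSum.coe_decompose_mul_of_right_mem 𝒯 i y.2]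
        split_ifs
        · exact J.mul_mem_right _ _ (hx _)
        · exact J.zero_mem
      | add a b ha hb => rw [mul_add, map_add]; exact J.add_mem ha hb)
  have h : J ≤ J' := by
    refine TwoSidedIdeal.span_le.2 fun x hx => (TwoSidedIdeal.mem_mk' ..).2 fun i => ?_
    by_cases h : N = i
    · subst h
      rw [GradedRing.proj_apply, DirectSum.decompose_of_mem_same 𝒯 (hR hx)]
      exact TwoSidedIdeal.subset_span hx
    · rw [GradedRing.proj_apply, DirectSum.decompose_of_mem_ne 𝒯 (hR hx) h]
      exact J.zero_mem
  exact (TwoSidedIdeal.mem_mk' ..).1 (h hx) i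

lemma GradedRing.proj_eq_zero_of_mem_mul {i n : ℕ} (h : i < n) {x : T}
    (hx : x ∈ (⊤ : Submodule k T) * 𝒯 n) : GradedRing.proj 𝒯 i x = 0 := by
  induction hx using Submodule.mul_induction_on' with
  | mem_mul_mem a _ b hb =>
    rw [GradedRing.proj_apply, DirectSum.coe_decompose_mul_of_right_mem_of_not_le 𝒯 hb (by omega)]
  | add a _ b _ ha hb => rw [map_add, ha, hb, add_zero]

variable {A : Type*} [Ring A] [Algebra k A] (𝒜 : ℕ → Submodule k A) [GradedAlgebra 𝒜]

/-- Since `φ` commutes with the projections, the degree `n` component of any preimage is again a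
preimage. -/
lemma AlgHom.exists_mem_of_surjective {φ : T →ₐ[k] A} (hφ : Function.Surjective φ)
    (h : ∀ n, ∀ x ∈ 𝒯 n, φ x ∈ 𝒜 n) {n : ℕ} {a : A} (ha : a ∈ 𝒜 n) : ∃ x ∈ 𝒯 n, φ x = a := by
  obtain ⟨x, rfl⟩ := hφ a
  have key : φ (GradedRing.proj 𝒯 n x) = GradedRing.proj 𝒜 n (φ x) := by
    clear ha
    induction x using DirectSum.Decomposition.inductionOn 𝒯 with
    | zero => simp only [map_zero]
    | @homogeneous m x =>
      by_cases hm : m = n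
      · subst hm
        rw [GradedRing.proj_apply, GradedRing.proj_apply, DirectSum.decompose_of_mem_same 𝒯 x.2,
          DirectSum.decompose_of_mem_same 𝒜 (h _ _ x.2)]
      · rw [GradedRing.proj_apply, GradedRing.proj_apply, DirectSum.decompose_of_mem_ne 𝒯 x.2 hm,
          DirectSum.decompose_of_mem_ne 𝒜 (h _ _ x.2) hm, map_zero]
    | add x y hx hy => simp only [map_add, hx, hy]
  refine ⟨GradedRing.proj 𝒯 n x, (DirectSum.decompose 𝒯 x n).2, ?_⟩
  rw [key, GradedRing.proj_apply, DirectSum.decompose_of_mem_same 𝒜 ha]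

end

/-! ### From generating relations to a presentation by the tensor algebra -/

namespace TensorAlgebra

section

variable {k V κ : Type*} [Field k] [AddCommGroup V] [Module k V] (b : Module.Basis κ k V)

/-- An element of the tensor algebra is the sum of a scalar and of an element of `Tens(V) ⊗ V`. -/
lemma exists_eq_algebraMap_add (w : TensorAlgebra k V) : ∃ (c : k) (f : κ →₀ TensorAlgebra k V),
    w = algebraMap k (TensorAlgebra k V) c +
      Finsupp.linearCombination (TensorAlgebra k V) (fun j => ι k (b j)) f := by
  have key : ∃ c : k, w - algebraMap k (TensorAlgebra k V) c ∈
      Submodule.span (TensorAlgebra k V) (Set.range fun j => ι k (b j)) := by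
    induction w using TensorAlgebra.induction with
    | algebraMap c => exact ⟨c, by rw [sub_self]; exact zero_mem _⟩
    | ι x =>
      refine ⟨0, ?_⟩
      rw [map_zero, sub_zero, ← b.linearCombination_repr x, Finsupp.linearCombination_apply,
        Finsupp.sum, map_sum]
      refine sum_mem fun j _ => ?_
      rw [map_smul, Algebra.smul_def]
      exact Submodule.smul_mem _ _ (Submodule.subset_span ⟨j, rfl⟩)
    | mul x y hx hy =>
      obtain ⟨c, hc⟩ := hx
      obtain ⟨d, hd⟩ := hy
      refine ⟨c * d, ?_⟩
      have : x * y - algebraMap k (TensorAlgebra k V) (c * d) =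
          x • (y - algebraMap k (TensorAlgebra k V) d) +
            algebraMap k (TensorAlgebra k V) d • (x - algebraMap k (TensorAlgebra k V) c) := by
        rw [smul_eq_mul, smul_eq_mul, mul_sub, mul_sub, ← Algebra.commutes d x, ← map_mul,
          mul_comm d c]
        abel
      rw [this]
      exact add_mem (Submodule.smul_mem _ _ hd) (Submodule.smul_mem _ _ hc)
    | add x y hx hy =>
      obtain ⟨c, hc⟩ := hx
      obtain ⟨d, hd⟩ := hy
      refine ⟨c + d, ?_⟩
      rw [map_add, add_sub_add_comm]
      exact add_mem hc hd
  obtain ⟨c, hc⟩ := key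
  rw [← Finsupp.range_linearCombination] at hc
  obtain ⟨f, hf⟩ := hc
  exact ⟨c, f, by rw [hf]; abel⟩

end

variable {k V κ A : Type*} [Field k] [AddCommGroup V] [Module k V] (b : Module.Basis κ k V)
  [Ring A] [Algebra k A] (𝒜 : ℕ → Submodule k A) [GradedAlgebra 𝒜]

lemma map_pow_range_le {φ : TensorAlgebra k V →ₐ[k] A} (h₁ : ∀ x, φ (ι k x) ∈ 𝒜 1) (n : ℕ) :
    ∀ x ∈ LinearMap.range (ι k : V →ₗ[k] TensorAlgebra k V) ^ n, φ x ∈ 𝒜 n := by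
  induction n with
  | zero =>
    intro x hx
    rw [pow_zero] at hx
    obtain ⟨c, rfl⟩ := Submodule.mem_one.1 hx
    rw [AlgHom.commutes]
    exact SetLike.algebraMap_mem_graded 𝒜 c
  | succ n ih =>
    intro x hx
    rw [pow_succ] at hx
    induction hx using Submodule.mul_induction_on' with
    | mem_mul_mem a ha b hb =>
      obtain ⟨y, rfl⟩ := hb
      rw [map_mul]
      exact SetLike.mul_mem_graded (ih a ha) (h₁ y)
    | add x _ y _ hx hy => rw [map_add]; exact add_mem hx hy

/-- If the relations between the generators `φ (b j)` of the left ideal `A_{≥ 1}` are generated by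
relations with coefficients of degree `m`, then the kernel of `φ : Tens(V) → A` is generated by
elements of degree `m + 1`. -/
theorem ker_eq_span {φ : TensorAlgebra k V →ₐ[k] A} (h₁ : ∀ x, φ (ι k x) ∈ 𝒜 1)
    (hinj : Function.Injective (algebraMap k A)) (hφ : Function.Surjective φ) (m : ℕ)
    (hrel : ∀ f : κ →₀ A, Finsupp.linearCombination A (fun j => φ (ι k (b j))) f = 0 →
      f ∈ Submodule.span A {g : κ →₀ A |
        Finsupp.linearCombination A (fun j => φ (ι k (b j))) g = 0 ∧ ∀ j, g j ∈ 𝒜 m}) :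
    TwoSidedIdeal.ker φ = TwoSidedIdeal.span
      (LinearMap.ker φ.toLinearMap ⊓ LinearMap.range (ι k : V →ₗ[k] TensorAlgebra k V) ^ (m + 1) :
        Submodule k (TensorAlgebra k V)) := by
  let T := TensorAlgebra k V
  let 𝒯 : ℕ → Submodule k T := fun n => LinearMap.range (ι k : V →ₗ[k] TensorAlgebra k V) ^ n
  let : GradedAlgebra 𝒯 := TensorAlgebra.gradedAlgebra
  set R : Submodule k T := LinearMap.ker φ.toLinearMap ⊓ 𝒯 (m + 1)
  set J := TwoSidedIdeal.span (R : Set T)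
  have hmap : ∀ n, ∀ x ∈ 𝒯 n, φ x ∈ 𝒜 n := map_pow_range_le 𝒜 h₁
  have hcomp : ∀ f : κ →₀ T, φ (Finsupp.linearCombination T (fun j => ι k (b j)) f) =
      Finsupp.linearCombination A (fun j => φ (ι k (b j))) (f.mapRange φ (map_zero φ)) := by
    intro f
    rw [Finsupp.linearCombination_apply, Finsupp.linearCombination_apply,
      Finsupp.sum_mapRange_index (fun _ => by exact zero_smul A _), Finsupp.sum, map_sum]
    exact Finset.sum_congr rfl fun j _ => map_mul φ _ _
  -- Every combination of degree `m` relations lifts to coefficients in the tensor algebra whose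
  -- combination lies in `J`: the lift of a degree `m` relation is an element of `R`.
  have hlift : ∀ F ∈ Submodule.span A {g : κ →₀ A |
        Finsupp.linearCombination A (fun j => φ (ι k (b j))) g = 0 ∧ ∀ j, g j ∈ 𝒜 m},
      ∃ h : κ →₀ T, h.mapRange φ (map_zero φ) = F ∧
        Finsupp.linearCombination T (fun j => ι k (b j)) h ∈ J := by
    intro F hF
    induction hF using Submodule.span_induction with
    | mem g hg =>
      -- A set-theoretic section of `φ` that respects degree `m`, and sends `0` to `0` so that it
      -- applies to finitely supported families.
      have hs : ∀ a : A, ∃ t : T, φ t = a ∧ (a ∈ 𝒜 m → t ∈ 𝒯 m) ∧ (a = 0 → t = 0) := by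
        intro a
        by_cases h0 : a = 0
        · exact ⟨0, by rw [h0, map_zero], fun _ => zero_mem _, fun _ => rfl⟩
        · by_cases ha : a ∈ 𝒜 m
          · obtain ⟨t, ht, hta⟩ := AlgHom.exists_mem_of_surjective 𝒯 𝒜 hφ hmap ha
            exact ⟨t, hta, fun _ => ht, fun h => (h0 h).elim⟩
          · obtain ⟨t, hta⟩ := hφ a
            exact ⟨t, hta, fun h => (ha h).elim, fun h => (h0 h).elim⟩
      choose s hs₁ hs₂ hs₃ using hs
      have hh : (g.mapRange s (hs₃ 0 rfl)).mapRange φ (map_zero φ) = g := by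
        ext j
        simp [hs₁]
      refine ⟨g.mapRange s (hs₃ 0 rfl), hh, TwoSidedIdeal.subset_span ⟨?_, ?_⟩⟩
      · change φ _ = 0
        rw [hcomp, hh, hg.1]
      · rw [Finsupp.linearCombination_apply]
        refine sum_mem fun j _ => ?_
        change _ ∈ LinearMap.range (ι k : V →ₗ[k] TensorAlgebra k V) ^ (m + 1)
        rw [pow_succ]
        exact Submodule.mul_mem_mul (hs₂ _ (hg.2 j)) ⟨b j, rfl⟩
    | zero => exact ⟨0, by simp, by rw [map_zero]; exact J.zero_mem⟩
    | add F G _ _ hF hG =>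
      obtain ⟨f, rfl, hf⟩ := hF
      obtain ⟨g, rfl, hg⟩ := hG
      exact ⟨f + g, Finsupp.mapRange_add (map_add φ) f g, by rw [map_add]; exact J.add_mem hf hg⟩
    | smul a F _ hF =>
      obtain ⟨f, rfl, hf⟩ := hF
      obtain ⟨t, rfl⟩ := hφ a
      refine ⟨t • f, by ext j; simp, ?_⟩
      rw [map_smul]
      exact J.mul_mem_left _ _ hf
  let I : Submodule k T := LinearMap.ker φ.toLinearMap
  let Jk : Submodule k T :=
    { carrier := J
      zero_mem' := J.zero_mem
      add_mem' := J.add_mem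
      smul_mem' := fun c x hx => by
        rw [Algebra.smul_def]
        exact J.mul_mem_left _ _ hx }
  -- Write `w ∈ I` as `c + ∑ f_j x_j`. Comparing degrees gives `c = 0`; the image of `f` is a
  -- relation, with a lift `h` such that `∑ h_j x_j ∈ J`, and `f - h` has coefficients in `I`.
  have hstep : I ≤ Jk ⊔ I * 𝒯 1 := by
    intro w hw
    obtain ⟨c, f, rfl⟩ := exists_eq_algebraMap_add b w
    have hw' : algebraMap k A c +
        Finsupp.linearCombination A (fun j => φ (ι k (b j))) (f.mapRange φ (map_zero φ)) = 0 := by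
      rw [← hcomp, ← AlgHom.commutes φ, ← map_add]
      exact hw
    have hc : c = 0 := by
      have h1 : Finsupp.linearCombination A (fun j => φ (ι k (b j)))
          (f.mapRange φ (map_zero φ)) ∈ (HomogeneousIdeal.irrelevant 𝒜).toIdeal := by
        rw [Finsupp.linearCombination_apply]
        exact sum_mem fun j _ => Ideal.mul_mem_left _ _
          (HomogeneousIdeal.mem_irrelevant_of_mem 𝒜 one_pos (h₁ _))
      rw [eq_neg_of_add_eq_zero_right hw', neg_mem_iff] at h1
      have h2 := (HomogeneousIdeal.mem_irrelevant_iff 𝒜 _).1 h1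
      rw [GradedRing.proj_apply, DirectSum.decompose_of_mem_same 𝒜
        (SetLike.algebraMap_mem_graded 𝒜 c)] at h2
      exact hinj (h2.trans (map_zero _).symm)
    subst hc
    rw [map_zero, zero_add] at hw' ⊢
    obtain ⟨h, hhf, hhJ⟩ := hlift _ (hrel _ hw')
    rw [← sub_add_cancel f h, map_add, add_comm]
    refine Submodule.add_mem_sup hhJ ?_
    rw [Finsupp.linearCombination_apply]
    refine sum_mem fun j _ => Submodule.mul_mem_mul ?_ ?_
    · change φ ((f - h) j) = 0
      have := DFunLike.congr_fun hhf j
      rw [Finsupp.mapRange_apply, Finsupp.mapRange_apply] at this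
      rw [Finsupp.sub_apply, map_sub, this, sub_self]
    · change _ ∈ LinearMap.range (ι k : V →ₗ[k] TensorAlgebra k V) ^ 1
      rw [pow_one]
      exact ⟨b j, rfl⟩
  have hpow : ∀ n, I ≤ Jk ⊔ I * 𝒯 n := by
    intro n
    induction n with
    | zero =>
      change I ≤ Jk ⊔ I * LinearMap.range (ι k : V →ₗ[k] TensorAlgebra k V) ^ 0
      rw [pow_zero, mul_one]
      exact le_sup_right
    | succ n ih =>
      refine ih.trans (sup_le le_sup_left ?_)
      refine (mul_le_mul' hstep le_rfl).trans ?_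
      rw [Submodule.sup_mul, mul_assoc]
      refine sup_le_sup ?_ ?_
      · rw [Submodule.mul_le]
        exact fun x hx y _ => J.mul_mem_right _ _ hx
      · refine mul_le_mul' le_rfl ?_
        change LinearMap.range (ι k : V →ₗ[k] TensorAlgebra k V) ^ 1 * _ ≤ _
        rw [← pow_add, add_comm]
  refine le_antisymm (fun w hw => ?_) (TwoSidedIdeal.span_le.2 fun x hx => ?_)
  · classical
    rw [← DirectSum.sum_support_decompose 𝒯 w]
    refine sum_mem fun i _ => ?_
    -- The iterated inclusion is used with exponent `i + 1`, so that the error term has no component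
    -- in degree `i`; homogeneity of `J` does the rest.
    obtain ⟨x, hx, y, hy, rfl⟩ := Submodule.mem_sup.1 (hpow (i + 1) ((TwoSidedIdeal.mem_ker φ).1 hw))
    rw [← GradedRing.proj_apply, map_add,
      GradedRing.proj_eq_zero_of_mem_mul 𝒯 i.lt_succ_self
        ((mul_le_mul' le_top le_rfl : I * 𝒯 (i + 1) ≤ ⊤ * 𝒯 (i + 1)) hy),
      add_zero]
    exact TwoSidedIdeal.proj_mem_span 𝒯 (fun x hx => hx.2) hx i
  · exact (TwoSidedIdeal.mem_ker φ).2 hx.1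

end TensorAlgebra

/-! ### Consequences of the Ext conditions for minimal generators -/

namespace GradedLeftModule

variable {k : Type v} {A : Type u} [Field k] [Ring A] [Algebra k A] {𝒜 : ℕ → Submodule k A}

lemma tensorAlgebra_lift_surjective (hgen : Algebra.adjoin k (𝒜 1 : Set A) = ⊤) :
    Function.Surjective (TensorAlgebra.lift k (𝒜 1).subtype) := by
  rw [← AlgHom.range_eq_top, eq_top_iff, ← hgen]
  exact Algebra.adjoin_le fun a ha => ⟨TensorAlgebra.ι k ⟨a, ha⟩, by simp⟩

lemma tensorAlgebra_lift_ι_mem (x : 𝒜 1) :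
    TensorAlgebra.lift k (𝒜 1).subtype (TensorAlgebra.ι k x) ∈ 𝒜 1 := by
  rw [TensorAlgebra.lift_ι_apply]
  exact x.2

variable [GradedAlgebra 𝒜]

lemma exists_mem_of_mem_intComponent_of_mem_irrelevant {z : ℤ} {a : A}
    (ha : a ∈ intComponent 𝒜 z) (ha' : a ∈ HomogeneousIdeal.irrelevant 𝒜) (h : a ≠ 0) :
    ∃ n : ℕ, z = (n + 1 : ℕ) ∧ a ∈ 𝒜 (n + 1) := by
  rcases eq_zero_or_mem_of_mem_intComponent 𝒜 ha with rfl | ⟨n, rfl, hn⟩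
  · exact (h rfl).elim
  · cases n with
    | zero =>
      rw [HomogeneousIdeal.mem_irrelevant_iff, GradedRing.proj_apply,
        DirectSum.decompose_of_mem_same 𝒜 hn] at ha'
      exact (h ha').elim
    | succ n => exact ⟨n, rfl, hn⟩

lemma apply_mem_irrelevant {ι : Type*} {x : ι →₀ A}
    (hx : ∀ i, x i ∈ HomogeneousIdeal.irrelevant 𝒜) (g : (ι →₀ A) →ₗ[A] A) :
    g x ∈ HomogeneousIdeal.irrelevant 𝒜 := by
  rw [← Finsupp.sum_single x, Finsupp.sum, map_sum]
  refine sum_mem fun i _ => ?_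
  rw [← mul_one (x i), ← smul_eq_mul, ← Finsupp.smul_single, map_smul]
  exact mul_mem_irrelevant (hx i) _

lemma linearMap_eq_linearCombination {ι : Type*} (g : (ι →₀ A) →ₗ[A] A) :
    g = Finsupp.linearCombination A fun i => g (Finsupp.single i 1) := by
  ext i
  simp

lemma projZeroRingHom_algebraMap (c : k) :
    GradedRing.projZeroRingHom 𝒜 (algebraMap k A c) = algebraMap k A c :=
  DirectSum.decompose_of_mem_same 𝒜 (SetLike.algebraMap_mem_graded 𝒜 c)

namespace MinimalGenerators

variable {M : GradedLeftModule 𝒜} (G : M.MinimalGenerators)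

lemma proj_injective [Nontrivial A] (hM : M.BoundedBelow) (hP : Module.Projective A M.carrier) :
    Function.Injective G.proj := by
  have := G.subsingleton_syzygy hM hP
  rw [← LinearMap.ker_eq_bot]
  exact (Submodule.subsingleton_iff_eq_bot).1 this

/-- Maps to `A` may be prescribed on the generators of a projective module. -/
lemma exists_map_of_projective [Nontrivial A] (hM : M.BoundedBelow)
    (hP : Module.Projective A M.carrier) (y : G.ι → A) :
    ∃ f : M.carrier →ₗ[A] A, ∀ i, f (G.gen i) = y i := by
  let E := LinearEquiv.ofBijective G.proj ⟨G.proj_injective hM hP, G.proj_surjective⟩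
  refine ⟨(Finsupp.linearCombination A y).comp E.symm.toLinearMap, fun i => ?_⟩
  have : E (Finsupp.single i 1) = G.gen i := by
    change G.proj (Finsupp.single i 1) = G.gen i
    rw [Finsupp.linearCombination_single, one_smul]
  rw [← this]
  simp

lemma isEmpty_of_subsingleton [Nontrivial A] (h : Subsingleton M.carrier) : IsEmpty G.ι :=
  ⟨fun i => G.gen_ne_zero i (Subsingleton.elim _ _)⟩

variable {G}

/-- If the syzygies `K` of `M` are projective and `Ext¹(M, A)` is one-dimensional, then `K` is free
on one element, and the coefficients of that element generate the right ideal `A_{≥ 1}`. -/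
theorem exists_unique_generator_of_ext (hinj : Function.Injective (algebraMap k A))
    (hM : M.BoundedBelow) (hP : Module.Projective A G.syzygy.carrier)
    (G' : G.syzygy.MinimalGenerators)
    (e : Abelian.Ext (ModuleCat.of A M.carrier) (ModuleCat.of A A) 1 ≃ₗ[k] k) :
    ∃ i₀ : G'.ι, (∀ i, i = i₀) ∧ ∀ a ∈ HomogeneousIdeal.irrelevant 𝒜,
      ∃ b : G.ι → A, Finsupp.linearCombination A b (G'.gen i₀).1 = a := by
  classical
  have : Nontrivial A := hinj.nontrivial
  obtain ⟨f₀, hf₀, hf⟩ := LinearMap.exists_generator_modulo_extensions G.proj_surjective e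
  let ε := GradedRing.projZeroRingHom 𝒜
  -- The syzygies are free on `G'`, so any `y` is the value vector of a map, which is `c • f₀` plus
  -- an extendable map `g`. As generators of syzygies have coefficients in `A_{≥1}`, so does `g`
  -- take its values there: modulo `A_{≥1}`, every `y` is a multiple of the vector of `f₀`.
  have hε : ∀ y : G'.ι → A, ∃ (c : k) (g : (G.ι →₀ A) →ₗ[A] A),
      (∀ i, g (G'.gen i).1 = y i - algebraMap k A c * f₀ (G'.gen i)) ∧
      ∀ i, ε (y i) = algebraMap k A c * ε (f₀ (G'.gen i)) := by
    intro y
    obtain ⟨f, hfy⟩ := G'.exists_map_of_projective (G.syzygy_boundedBelow hM) hP y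
    obtain ⟨c, g, hg⟩ := hf f
    have hg' : ∀ i, g (G'.gen i).1 = y i - algebraMap k A c * f₀ (G'.gen i) := fun i => by
      rw [hg, hfy, smul_eq_mul]
    refine ⟨c, g, hg', fun i => ?_⟩
    have h0 : ε (g (G'.gen i).1) = 0 := apply_mem_irrelevant (G.coeff_mem (G'.gen i)) g
    rw [hg', map_sub, map_mul, projZeroRingHom_algebraMap, sub_eq_zero] at h0
    exact h0
  have hone : ∀ i, ∃ c : k, algebraMap k A c * ε (f₀ (G'.gen i)) = 1 ∧
      ∀ j, j ≠ i → algebraMap k A c * ε (f₀ (G'.gen j)) = 0 := by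
    intro i
    obtain ⟨c, -, -, hc⟩ := hε (Pi.single i 1)
    refine ⟨c, ?_, fun j hj => ?_⟩
    · rw [← hc, Pi.single_eq_same, map_one]
    · rw [← hc, Pi.single_eq_of_ne hj, map_zero]
  -- Without generators the syzygies vanish, and `f₀ = 0` would extend.
  have hne : Nonempty G'.ι := by
    by_contra h
    rw [not_nonempty_iff] at h
    have : Subsingleton G.syzygy.carrier := G'.proj_surjective.subsingleton
    exact hf₀ ⟨0, fun x => by
      rw [Subsingleton.elim (α := G.syzygy.carrier) x 0, map_zero, LinearMap.zero_apply]⟩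
  obtain ⟨i₀⟩ := hne
  refine ⟨i₀, fun i => ?_, fun a ha => ?_⟩
  · by_contra hi
    obtain ⟨c, hc, -⟩ := hone i
    obtain ⟨d, hd, hd'⟩ := hone i₀
    have h1 : d ≠ 0 := by
      rintro rfl
      rw [map_zero, zero_mul] at hd
      exact zero_ne_one hd
    have h2 : ε (f₀ (G'.gen i)) = 0 := by
      rw [← one_mul (ε (f₀ (G'.gen i))), ← map_one (algebraMap k A), ← inv_mul_cancel₀ h1, map_mul,
        mul_assoc, hd' i hi, mul_zero]
    rw [h2, mul_zero] at hc
    exact zero_ne_one hc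
  -- For `a ∈ A_{≥1}` the constant `c` is zero, so the map with value `a` at the generator extends;
  -- its values on the basis of the cover are the required right coefficients.
  · obtain ⟨c, g, hg, hc⟩ := hε fun _ => a
    obtain ⟨d, hd, -⟩ := hone i₀
    have hc0 : c = 0 := by
      apply hinj
      rw [map_zero, ← mul_one (algebraMap k A c), ← hd, ← mul_assoc, ← map_mul, mul_comm c d,
        map_mul, mul_assoc, ← hc, show ε a = 0 from ha, mul_zero]
    refine ⟨fun i => g (Finsupp.single i 1), ?_⟩
    rw [← linearMap_eq_linearCombination, hg, hc0, map_zero, zero_mul, sub_zero]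

/-- If all maps from the syzygies `K` of `M` to `A` extend to the free cover of `M`, then the maps
to `A` from the free cover of `K` that vanish on its syzygies take values in `A_{≥ 1}`. -/
lemma mem_irrelevant_of_extension {G' : G.syzygy.MinimalGenerators}
    (hext : ∀ f : G.syzygy.carrier →ₗ[A] A, ∃ g : (G.ι →₀ A) →ₗ[A] A,
      ∀ x : G.syzygy.carrier, g x.1 = f x)
    {b : G'.ι → A} (hb : ∀ x : G'.syzygy.carrier, Finsupp.linearCombination A b x.1 = 0)
    (i : G'.ι) : b i ∈ HomogeneousIdeal.irrelevant 𝒜 := by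
  have hker : LinearMap.ker G'.proj ≤ LinearMap.ker (Finsupp.linearCombination A b) :=
    fun x hx => hb ⟨x, hx⟩
  -- The map given by `b` descends to the syzygies `K` of `M`. Its extension to the cover of `M`
  -- takes values in `A_{≥1}` on `K`, because elements of `K` have coefficients in `A_{≥1}`.
  let f : G.syzygy.carrier →ₗ[A] A :=
    ((LinearMap.ker G'.proj).liftQ (Finsupp.linearCombination A b) hker).comp
      (G'.proj.quotKerEquivOfSurjective G'.proj_surjective).symm.toLinearMap
  have hf : f (G'.gen i) = b i := by
    have : G'.proj.quotKerEquivOfSurjective G'.proj_surjective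
        (Submodule.Quotient.mk (Finsupp.single i 1)) = G'.gen i := by
      rw [LinearMap.quotKerEquivOfSurjective_apply_mk]
      simp
    rw [← this, LinearMap.comp_apply, LinearEquiv.coe_coe, LinearEquiv.symm_apply_apply,
      Submodule.liftQ_apply, Finsupp.linearCombination_single, one_smul]
  obtain ⟨g, hg⟩ := hext f
  rw [← hf, ← hg]
  exact apply_mem_irrelevant (G.coeff_mem _) g

lemma exists_coeff_ne_zero [Nontrivial A] (G' : G.syzygy.MinimalGenerators) (i : G'.ι) :
    ∃ j, (G'.gen i).1 j ≠ 0 := by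
  by_contra! h
  exact G'.gen_ne_zero i (Subtype.ext (Finsupp.ext h))

end MinimalGenerators

/-! ### The minimal resolution -/

variable (𝒜)

/-- A graded module that is bounded below, with a minimal system of generators. -/
structure ResolutionStage where
  M : GradedLeftModule 𝒜
  boundedBelow : M.BoundedBelow
  gens : M.MinimalGenerators

variable {𝒜}

/-- The syzygies of a stage. -/
noncomputable def ResolutionStage.next [Nontrivial A]
    (h : 𝒜 0 = LinearMap.range (Algebra.linearMap k A)) (s : ResolutionStage 𝒜) :
    ResolutionStage 𝒜 where
  M := s.gens.syzygy
  boundedBelow := s.gens.syzygy_boundedBelow s.boundedBelow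
  gens := (exists_minimalGenerators h _ (s.gens.syzygy_boundedBelow s.boundedBelow)).some

/-- The iterated syzygies of a stage. -/
noncomputable def ResolutionStage.iterate [Nontrivial A]
    (h : 𝒜 0 = LinearMap.range (Algebra.linearMap k A)) (s : ResolutionStage 𝒜) :
    ℕ → ResolutionStage 𝒜
  | 0 => s
  | n + 1 => (s.iterate h n).next h

variable (𝒜)

/-- The graded module `A_{≥ 1}`. -/
abbrev irrelevantModule : GradedLeftModule 𝒜 :=
  (regular 𝒜).ofSubmodule (LinearMap.ker (HomogeneousIdeal.irrelevant 𝒜).toIdeal.mkQ) <| by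
    intro n x hx
    rw [Submodule.ker_mkQ] at hx ⊢
    refine mem_of_mem_irrelevant ((HomogeneousIdeal.irrelevant 𝒜).toIdeal.toAddSubgroup.comap
      ((regular 𝒜).pr n)) (fun i hi a ha => ?_) hx
    have ha' : a ∈ (regular 𝒜).deg i := (mem_intComponent_natCast 𝒜).2 ha
    rw [AddSubgroup.mem_comap]
    by_cases h : (i : ℤ) = n
    · subst h
      rw [(regular 𝒜).pr_of_mem ha']
      exact HomogeneousIdeal.mem_irrelevant_of_mem 𝒜 hi ha
    · rw [(regular 𝒜).pr_of_mem_ne ha' h]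
      exact zero_mem _

lemma irrelevantModule_boundedBelow : (irrelevantModule 𝒜).BoundedBelow :=
  (regular_boundedBelow 𝒜).ofSubmodule _ _

variable {𝒜}

/-- Holds in the tensor algebra on `A_1`, where the degree `n + 1` part is a product by
construction, and passes to its graded quotient `A`. -/
lemma le_mul_of_adjoin_eq_top (hgen : Algebra.adjoin k (𝒜 1 : Set A) = ⊤) (n : ℕ) :
    𝒜 (n + 1) ≤ 𝒜 n * 𝒜 1 := by
  intro a ha
  have hmap := TensorAlgebra.map_pow_range_le 𝒜 (tensorAlgebra_lift_ι_mem (𝒜 := 𝒜))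
  obtain ⟨x, hx, rfl⟩ := AlgHom.exists_mem_of_surjective
    (fun n => LinearMap.range (TensorAlgebra.ι k : 𝒜 1 →ₗ[k] TensorAlgebra k (𝒜 1)) ^ n) 𝒜
    (tensorAlgebra_lift_surjective hgen) hmap ha
  clear ha
  rw [pow_succ] at hx
  induction hx using Submodule.mul_induction_on' with
  | mem_mul_mem a ha b hb =>
    rw [map_mul]
    exact Submodule.mul_mem_mul (hmap _ _ ha) (hmap 1 _ (by rwa [pow_one]))
  | add x _ y _ hx hy => rw [map_add]; exact add_mem hx hy

lemma mem_span_range_of_val_mem {A ι M : Type*} [Ring A] [AddCommGroup M] [Module A M] {L : Submodule A M}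
    {g : ι → L} {x : L} (hx : x.1 ∈ Submodule.span A (Set.range fun i => (g i).1)) :
    x ∈ Submodule.span A (Set.range g) := by
  have h : Submodule.span A (Set.range fun i => (g i).1) =
      (Submodule.span A (Set.range g)).map L.subtype := by
    rw [Submodule.map_span, ← Set.range_comp]
    rfl
  rw [h] at hx
  obtain ⟨y, hy, hyx⟩ := hx
  rwa [← show y = x from Subtype.ext hyx]

/-- A basis of `A_1` is a minimal system of generators of `A_{≥ 1}`. -/
noncomputable abbrev irrelevantGenerators (h : 𝒜 0 = LinearMap.range (Algebra.linearMap k A))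
    (hgen : Algebra.adjoin k (𝒜 1 : Set A) = ⊤) : (irrelevantModule 𝒜).MinimalGenerators where
  ι := Module.Free.ChooseBasisIndex k (𝒜 1)
  δ _ := 1
  gen j := ⟨(Module.Free.chooseBasis k (𝒜 1) j : A), by
    rw [Submodule.ker_mkQ]
    exact HomogeneousIdeal.mem_irrelevant_of_mem 𝒜 one_pos (Subtype.prop _)⟩
  gen_mem j := (mem_intComponent_natCast 𝒜 (n := 1)).2 (Subtype.prop _)
  span_eq_top := by
    let b := Module.Free.chooseBasis k (𝒜 1)
    let S : Submodule A A := Submodule.span A (Set.range fun j => (b j : A))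
    have h1 : ∀ q ∈ 𝒜 1, q ∈ S := by
      intro q hq
      have := congrArg Subtype.val (b.linearCombination_repr ⟨q, hq⟩)
      rw [Finsupp.linearCombination_apply, Finsupp.sum, AddSubmonoidClass.coe_finsetSum] at this
      dsimp only at this
      rw [← this]
      refine sum_mem fun j _ => ?_
      rw [Submodule.coe_smul, Algebra.smul_def]
      exact S.smul_mem _ (Submodule.subset_span ⟨j, rfl⟩)
    have h2 : ∀ a ∈ HomogeneousIdeal.irrelevant 𝒜, a ∈ S := by
      intro a ha
      refine mem_of_mem_irrelevant S.toAddSubgroup (fun i hi a ha => ?_) ha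
      obtain ⟨n, rfl⟩ := Nat.exists_eq_succ_of_ne_zero hi.ne'
      exact Submodule.mul_induction_on (C := fun x => x ∈ S) (le_mul_of_adjoin_eq_top hgen n ha)
        (fun p _ q hq => S.smul_mem p (h1 q hq)) fun x y hx hy => add_mem hx hy
    refine Submodule.eq_top_iff'.2 fun x => ?_
    exact mem_span_range_of_val_mem (h2 x.1 ((Submodule.ker_mkQ _).le x.2))
  minimal f hf j := by
    let b := Module.Free.chooseBasis k (𝒜 1)
    have hf' : ∑ j ∈ f.support, f j * (b j : A) = 0 := by
      have := congrArg Subtype.val hf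
      rwa [Finsupp.linearCombination_apply, Finsupp.sum, AddSubmonoidClass.coe_finsetSum] at this
    choose c hc using fun j => exists_algebraMap_sub_mem h (f j)
    have hc' : ∀ j, GradedRing.proj 𝒜 0 (f j) = algebraMap k A (c j) := fun j => by
      have h1 : GradedRing.projZeroRingHom 𝒜 (f j - algebraMap k A (c j)) = 0 := hc j
      rw [map_sub, projZeroRingHom_algebraMap, sub_eq_zero] at h1
      exact h1
    -- This is the degree `1` component of the relation: only the constant terms of the coefficients
    -- contribute.
    have h0 : ∑ j ∈ f.support, c j • b j = 0 := by
      apply Subtype.ext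
      rw [AddSubmonoidClass.coe_finsetSum, ZeroMemClass.coe_zero, ← map_zero (GradedRing.proj 𝒜 1),
        ← hf', map_sum]
      refine Finset.sum_congr rfl fun j _ => ?_
      rw [GradedRing.proj_apply, DirectSum.coe_decompose_mul_of_right_mem_of_le 𝒜 (b j).2 le_rfl,
        Nat.sub_self, ← GradedRing.proj_apply, hc', Submodule.coe_smul, Algebra.smul_def]
    by_cases hj : j ∈ f.support
    · have := hc j
      rwa [linearIndependent_iff'.1 b.linearIndependent f.support c h0 j hj, map_zero,
        sub_zero] at this
    · rw [Finsupp.notMem_support_iff.1 hj]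
      exact zero_mem _

/-- Splices short exact sequences into the resolution; `j` is the inclusion of a syzygy module in
the preceding free module, or the identity at the augmentation. -/
lemma exact_subtype_comp {A F' F M N : Type*} [Ring A] [AddCommGroup F'] [Module A F'] [AddCommGroup F]
    [Module A F] [AddCommGroup M] [Module A M] [AddCommGroup N] [Module A N] {π : F →ₗ[A] M}
    {p : F' →ₗ[A] LinearMap.ker π} (hp : Function.Surjective p) {j : M →ₗ[A] N}
    (hj : Function.Injective j) : Function.Exact ((LinearMap.ker π).subtype.comp p) (j.comp π) := by
  intro x
  rw [LinearMap.comp_apply, map_eq_zero_iff j hj]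
  constructor
  · intro hx
    obtain ⟨y, hy⟩ := hp ⟨x, hx⟩
    exact ⟨y, congrArg Subtype.val hy⟩
  · rintro ⟨y, rfl⟩
    exact (p y).2

section

variable [Nontrivial A] (h : 𝒜 0 = LinearMap.range (Algebra.linearMap k A))
  (hgen : Algebra.adjoin k (𝒜 1 : Set A) = ⊤)

/-- The stages of the minimal resolution of `A_{≥ 1}`. -/
noncomputable abbrev stage : ℕ → ResolutionStage 𝒜 :=
  ResolutionStage.iterate h ⟨_, irrelevantModule_boundedBelow 𝒜, irrelevantGenerators h hgen⟩

/-- The minimal resolution of the trivial module. -/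
noncomputable def minimalResolution : GradedProjectiveResolution 𝒜 where
  X
    | 0 => regular 𝒜
    | i + 1 => (stage h hgen i).gens.cover
  projective
    | 0 => inferInstanceAs (Module.Projective A A)
    | i + 1 => inferInstanceAs (Module.Projective A ((stage h hgen i).gens.ι →₀ A))
  d
    | 0 => (LinearMap.ker (HomogeneousIdeal.irrelevant 𝒜).toIdeal.mkQ).subtype.comp
        (stage h hgen 0).gens.proj
    | i + 1 => (LinearMap.ker (stage h hgen i).gens.proj).subtype.comp
        (stage h hgen (i + 1)).gens.proj
  d_mem
    | 0, n, x, hx => (stage h hgen 0).gens.proj_mem n x hx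
    | i + 1, n, x, hx => (stage h hgen (i + 1)).gens.proj_mem n x hx
  aug := (HomogeneousIdeal.irrelevant 𝒜).toIdeal.mkQ
  aug_deg n hn x hx := by
    rw [Submodule.mkQ_apply, Submodule.Quotient.mk_eq_zero]
    exact hx 0 (by simpa using hn.symm)
  aug_surjective := Submodule.mkQ_surjective _
  exact_zero := exact_subtype_comp (stage h hgen 0).gens.proj_surjective (j := LinearMap.id)
    Function.injective_id
  exact_succ
    | 0 => exact_subtype_comp (stage h hgen 1).gens.proj_surjective Subtype.val_injective
    | i + 1 => exact_subtype_comp (stage h hgen (i + 2)).gens.proj_surjective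
        Subtype.val_injective

end

end GradedLeftModule

/-! ### Length and generator degrees of the minimal resolution -/

namespace GradedLeftModule

variable {k : Type v} {A : Type u} [Field k] [Ring A] [Algebra k A] {𝒜 : ℕ → Submodule k A}
  [GradedAlgebra 𝒜] (h : 𝒜 0 = LinearMap.range (Algebra.linearMap k A))
  (hgen : Algebra.adjoin k (𝒜 1 : Set A) = ⊤)

lemma irrelevantGenerators_proj_val (f : (irrelevantGenerators h hgen).ι →₀ A) :
    ((irrelevantGenerators h hgen).proj f).1 = Finsupp.linearCombination A
      (fun j => (Module.Free.chooseBasis k (𝒜 1) j : A)) f := by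
  rw [Finsupp.linearCombination_apply, Finsupp.linearCombination_apply, Finsupp.sum,
    AddSubmonoidClass.coe_finsetSum]
  rfl

variable [Nontrivial A]

/-- Stage `0` is `A_{≥1}`, already the first syzygy of `k`, so stage `j` is the syzygy of order `j +
1`. -/
lemma hasProjectiveDimensionLE_stage (j : ℕ) : ∀ n : ℕ,
    HasProjectiveDimensionLE (ModuleCat.of A (TrivialModule 𝒜)) (n + 1 + j) →
    HasProjectiveDimensionLE (ModuleCat.of A (stage h hgen j).M.carrier) n := by
  induction j with
  | zero => exact fun n hn => LinearMap.hasProjectiveDimensionLE_ker (Submodule.mkQ_surjective _) n hn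
  | succ j ih =>
    intro n hn
    exact LinearMap.hasProjectiveDimensionLE_ker (stage h hgen j).gens.proj_surjective n
      (ih (n + 1) (by rwa [show n + 1 + 1 + j = n + 1 + (j + 1) by omega]))

lemma subsingleton_stage {j : ℕ} (hj : Module.Projective A (stage h hgen j).M.carrier) (i : ℕ) :
    Subsingleton (stage h hgen (j + 1 + i)).M.carrier := by
  induction i with
  | zero => exact (stage h hgen j).gens.subsingleton_syzygy (stage h hgen j).boundedBelow hj
  | succ i ih =>
    have : Module.Free A (stage h hgen (j + 1 + i)).M.carrier := Module.Free.of_subsingleton A _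
    exact (stage h hgen (j + 1 + i)).gens.subsingleton_syzygy
      (stage h hgen (j + 1 + i)).boundedBelow Module.Projective.of_free

lemma isEmpty_stage {j : ℕ} (hj : Module.Projective A (stage h hgen j).M.carrier) {i : ℕ}
    (hi : j < i) : IsEmpty (stage h hgen i).gens.ι := by
  obtain ⟨i, rfl⟩ := Nat.exists_eq_add_of_lt hi
  refine (stage h hgen _).gens.isEmpty_of_subsingleton ?_
  rw [add_right_comm]
  exact subsingleton_stage h hgen hj i

/-- If the relations between the elements of a basis of `A_1` are generated in degree `N`, then `A`
is `N`-homogeneous. -/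
lemma isNHomogeneous_of_degree (hinj : Function.Injective (algebraMap k A))
    (hfin : Module.Finite k (𝒜 1)) {m : ℕ} (hm : 1 ≤ m)
    (G : (irrelevantGenerators h hgen).syzygy.MinimalGenerators)
    (hδ : ∀ i, G.δ i = (m + 1 : ℕ)) : IsNHomogeneous 𝒜 (m + 1) := by
  let b := Module.Free.chooseBasis k (𝒜 1)
  refine ⟨by omega, 𝒜 1, inferInstance, inferInstance, hfin, _,
    TensorAlgebra.lift k (𝒜 1).subtype, inf_le_right,
    tensorAlgebra_lift_ι_mem, tensorAlgebra_lift_surjective hgen,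
    TensorAlgebra.ker_eq_span b 𝒜 tensorAlgebra_lift_ι_mem hinj
      (tensorAlgebra_lift_surjective hgen) m fun f hf => ?_⟩
  simp only [TensorAlgebra.lift_ι_apply, Submodule.subtype_apply] at hf ⊢
  have hf' : f ∈ LinearMap.ker (irrelevantGenerators h hgen).proj :=
    Subtype.ext ((irrelevantGenerators_proj_val h hgen f).trans hf)
  have hspan : (⟨f, hf'⟩ : LinearMap.ker (irrelevantGenerators h hgen).proj) ∈
      Submodule.span A (Set.range G.gen) := G.span_eq_top ▸ Submodule.mem_top
  have := Submodule.mem_map_of_mem (f := Submodule.subtype _) hspan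
  rw [Submodule.map_span] at this
  refine Submodule.span_mono ?_ this
  rintro _ ⟨_, ⟨i, rfl⟩, rfl⟩
  refine ⟨(irrelevantGenerators_proj_val h hgen _).symm.trans (congrArg Subtype.val (G.gen i).2),
    fun j => ?_⟩
  have h1 := G.gen_mem i j
  rw [hδ] at h1
  have h2 : ((m + 1 : ℕ) : ℤ) - (irrelevantGenerators h hgen).δ j = m := by
    push_cast
    ring
  rw [h2] at h1
  exact (mem_intComponent_natCast 𝒜).1 h1

/-- The relations between the elements of a basis of `A_1` have degree at least `2`. -/
lemma exists_degree_eq (G : (irrelevantGenerators h hgen).syzygy.MinimalGenerators) (i : G.ι) :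
    ∃ m : ℕ, 1 ≤ m ∧ G.δ i = (m + 1 : ℕ) := by
  obtain ⟨j, hj⟩ := MinimalGenerators.exists_coeff_ne_zero G i
  obtain ⟨n, hn, -⟩ := exists_mem_of_mem_intComponent_of_mem_irrelevant (G.gen_mem i j)
    (MinimalGenerators.coeff_mem _ (G.gen i) j) hj
  have hn' : G.δ i - 1 = (n + 1 : ℕ) := hn
  exact ⟨n + 1, by omega, by omega⟩

/-- If the coefficients of a relation between the elements of a basis of `A_1` generate the right
ideal `A_{≥ 1}`, then this relation has degree `2`. -/
lemma degree_eq_two (G : (irrelevantGenerators h hgen).syzygy.MinimalGenerators) {i₀ : G.ι}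
    (hall : ∀ a ∈ HomogeneousIdeal.irrelevant 𝒜, ∃ b : (irrelevantGenerators h hgen).ι → A,
      Finsupp.linearCombination A b (G.gen i₀).1 = a) : G.δ i₀ = 2 := by
  obtain ⟨m, hm, hm'⟩ := exists_degree_eq h hgen G i₀
  obtain rfl | hlt := hm.eq_or_lt
  · rw [hm']
    rfl
  -- Only the index `j` is needed, to have a basis vector of `A_1`. It would be a right combination
  -- of coefficients of degree `m ≥ 2`, which has no component in degree `1`.
  obtain ⟨j, -⟩ := MinimalGenerators.exists_coeff_ne_zero G i₀
  let b := Module.Free.chooseBasis k (𝒜 1)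
  obtain ⟨c, hc⟩ := hall (b j) (HomogeneousIdeal.mem_irrelevant_of_mem 𝒜 one_pos (b j).2)
  refine (b.ne_zero j (Subtype.ext ?_)).elim
  rw [← DirectSum.decompose_of_mem_same 𝒜 (b j).2, ← hc, ← GradedRing.proj_apply,
    Finsupp.linearCombination_apply, Finsupp.sum, map_sum, ZeroMemClass.coe_zero]
  refine Finset.sum_eq_zero fun l _ => ?_
  have hl : (G.gen i₀).1 l ∈ 𝒜 m := by
    have h1 := G.gen_mem i₀ l
    rw [hm'] at h1
    have h2 : ((m + 1 : ℕ) : ℤ) - (irrelevantGenerators h hgen).δ l = m := by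
      push_cast
      ring
    rw [h2] at h1
    exact (mem_intComponent_natCast 𝒜).1 h1
  rw [smul_eq_mul, GradedRing.proj_apply,
    DirectSum.coe_decompose_mul_of_left_mem_of_not_le 𝒜 hl (by omega)]

/-- If the coefficients of a syzygy form a minimal system of generators of the right ideal
`A_{≥ 1}`, then they have degree `1`. -/
lemma MinimalGenerators.degree_eq_add_one {M : GradedLeftModule 𝒜} {G : M.MinimalGenerators}
    {G' : G.syzygy.MinimalGenerators} {i₀ : G'.ι}
    (hgen : Algebra.adjoin k (𝒜 1 : Set A) = ⊤)
    (hall : ∀ a ∈ HomogeneousIdeal.irrelevant 𝒜, ∃ b : G.ι → A,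
      Finsupp.linearCombination A b (G'.gen i₀).1 = a)
    (hmin : ∀ b : G.ι → A, Finsupp.linearCombination A b (G'.gen i₀).1 = 0 →
      ∀ i, b i ∈ HomogeneousIdeal.irrelevant 𝒜) (i : G.ι) : G'.δ i₀ = G.δ i + 1 := by
  classical
  let u : G.ι →₀ A := (G'.gen i₀).1
  have hlc : ∀ b, Finsupp.linearCombination A b u = ∑ j ∈ u.support, u j * b j := fun b =>
    Finsupp.linearCombination_apply A u
  have hone : Finsupp.linearCombination A (Pi.single i 1) u = u i := by
    rw [hlc]
    by_cases hi : i ∈ u.support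
    · rw [Finset.sum_eq_single_of_mem i hi fun j _ hj => by rw [Pi.single_eq_of_ne hj, mul_zero],
        Pi.single_eq_same, mul_one]
    · rw [Finsupp.notMem_support_iff.1 hi]
      exact Finset.sum_eq_zero fun j hj => by
        rw [Pi.single_eq_of_ne (ne_of_mem_of_not_mem hj hi), mul_zero]
  have hui : u i ≠ 0 := by
    intro h0
    have := hmin _ (hone.trans h0) i
    rw [Pi.single_eq_same] at this
    exact one_notMem_irrelevant this
  obtain ⟨n, hn, hun⟩ := exists_mem_of_mem_intComponent_of_mem_irrelevant (G'.gen_mem i₀ i)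
    (G.coeff_mem (G'.gen i₀) i) hui
  cases n with
  | zero => push_cast at hn; omega
  | succ n =>
    -- If `u i` had degree at least `2`, it would be a sum of products `x * y` with `x ∈ A_{≥1}` and
    -- `y ∈ A_1`. Expanding `x` in the coefficients of `u` gives `u i = ∑ u j * c j` with `c j ∈
    -- A_{≥1}`, a right relation whose coefficient `1 - c i` violates minimality.
    obtain ⟨c, hc, hcu⟩ : ∃ c : G.ι → A, (∀ j, c j ∈ HomogeneousIdeal.irrelevant 𝒜) ∧
        Finsupp.linearCombination A c u = u i := by
      refine Submodule.mul_induction_on (C := fun x => ∃ c : G.ι → A,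
        (∀ j, c j ∈ HomogeneousIdeal.irrelevant 𝒜) ∧ Finsupp.linearCombination A c u = x)
        (le_mul_of_adjoin_eq_top hgen _ hun) ?_ ?_
      · intro x hx y hy
        obtain ⟨b, hb⟩ := hall x (HomogeneousIdeal.mem_irrelevant_of_mem 𝒜 n.succ_pos hx)
        refine ⟨fun j => b j * y, fun j => Ideal.mul_mem_left _ _
          (HomogeneousIdeal.mem_irrelevant_of_mem 𝒜 one_pos hy), ?_⟩
        rw [← hb]
        change _ = Finsupp.linearCombination A b u * y
        rw [hlc, hlc, Finset.sum_mul]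
        exact Finset.sum_congr rfl fun j _ => (mul_assoc _ _ _).symm
      · rintro x y ⟨b, hb, rfl⟩ ⟨c, hc, rfl⟩
        refine ⟨b + c, fun j => add_mem (hb j) (hc j), ?_⟩
        rw [hlc, hlc, hlc, ← Finset.sum_add_distrib]
        exact Finset.sum_congr rfl fun j _ => mul_add _ _ _
    have h0 : Finsupp.linearCombination A (Pi.single i 1 - c) u = 0 := by
      rw [← sub_eq_zero.2 (hone.trans hcu.symm), hlc, hlc, hlc, ← Finset.sum_sub_distrib]
      exact Finset.sum_congr rfl fun j _ => mul_sub _ _ _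
    have h1 := hmin _ h0 i
    rw [Pi.sub_apply, Pi.single_eq_same] at h1
    have h2 := add_mem h1 (hc i)
    rw [sub_add_cancel] at h2
    exact (one_notMem_irrelevant h2).elim

/-- Stage `j` is covered by `X_{j+1}`, whose generators all have degree `n(j + 1)`. In any other
degree the coefficients of an element have no constant term, so `k ⊗ X_{j+1}` itself vanishes there,
before taking homology. -/
lemma isGeneralizedKoszul_of_degree {N : ℕ}
    (hδ : ∀ j, 2 ≤ j → ∀ i, (stage h hgen j).gens.δ i = jumpMap N (j + 1)) :
    IsGeneralizedKoszul 𝒜 N := by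
  refine ⟨minimalResolution h hgen, fun i hi n hn => ?_⟩
  obtain ⟨j, rfl⟩ := Nat.exists_eq_succ_of_ne_zero (show i ≠ 0 by omega)
  rw [GradedProjectiveResolution.subsingleton_tor_iff]
  intro x hx _
  refine ⟨0, zero_mem _, ?_⟩
  rw [map_zero, sub_zero]
  let f : (stage h hgen j).gens.ι →₀ A := x
  change f ∈ (stage h hgen j).gens.cover.aug
  rw [← Finsupp.sum_single f]
  refine sum_mem fun i _ => ?_
  rw [← mul_one (f i), ← smul_eq_mul, ← Finsupp.smul_single]
  refine smul_mem_aug _ ?_ _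
  have hi' : f i ∈ intComponent 𝒜 (n - (stage h hgen j).gens.δ i) := hx i
  rw [hδ j (by omega)] at hi'
  exact hi' 0 (by rw [Nat.cast_zero]; exact fun h0 => hn (sub_eq_zero.1 h0.symm))

end GradedLeftModule

/-! ### The theorem -/

open GradedLeftModule in
theorem proposition5p2 {k : Type v} {A : Type u} [Field k] [Ring A] [Algebra k A]
    (𝒜 : ℕ → Submodule k A) [GradedAlgebra 𝒜]
    (hconn : IsConnectedGraded 𝒜)
    (hfin : Module.Finite k (𝒜 1))
    (hgen : Algebra.adjoin k (𝒜 1 : Set A) = ⊤)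
    (D : ℕ) (hD : D = 2 ∨ D = 3)
    (hAS : IsASGorenstein 𝒜 D) :
    ∃ N : ℕ, 2 ≤ N ∧ (D = 2 → N = 2) ∧ IsNHomogeneous 𝒜 N ∧ IsGeneralizedKoszul 𝒜 N := by
  obtain ⟨hinj, h⟩ := hconn
  have : Nontrivial A := hinj.nontrivial
  obtain ⟨hgl, hvan, ⟨e⟩⟩ := hAS
  let s := stage h hgen
  let G₁ : (irrelevantModule 𝒜).MinimalGenerators := irrelevantGenerators h hgen
  let G₂ : G₁.syzygy.MinimalGenerators := (s 1).gens
  have hM : (irrelevantModule 𝒜).BoundedBelow := irrelevantModule_boundedBelow 𝒜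
  have hsurj := Submodule.mkQ_surjective (HomogeneousIdeal.irrelevant 𝒜).toIdeal
  -- The syzygy of order `D` is projective, and stage `j` has order `j + 1`.
  have hproj : ∀ j, D = j + 1 → Module.Projective A (s j).M.carrier := fun j hj =>
    ModuleCat.projective_of_hasProjectiveDimensionLE_zero
      (hasProjectiveDimensionLE_stage h hgen j 0 (by rw [zero_add, add_comm, ← hj]; exact hgl.1 _))
  rcases hD with rfl | rfl
  · obtain ⟨i₀, hi₀, hall⟩ := MinimalGenerators.exists_unique_generator_of_ext (G := G₁) hinj hM
      (hproj 1 rfl) G₂ ((LinearMap.extKerEquiv hsurj _ 0).trans e)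
    have hδ : G₂.δ i₀ = 2 := degree_eq_two h hgen G₂ hall
    refine ⟨2, le_rfl, fun _ => rfl,
      isNHomogeneous_of_degree h hgen hinj hfin (m := 1) le_rfl G₂ fun i => by rw [hi₀ i, hδ]; rfl,
      isGeneralizedKoszul_of_degree h hgen fun j hj i =>
        ((isEmpty_stage h hgen (hproj 1 rfl) hj).false i).elim⟩
  · let G₃ : G₂.syzygy.MinimalGenerators := (s 2).gens
    have hK : G₁.syzygy.BoundedBelow := (s 1).boundedBelow
    -- Two dimension shifts identify `Ext¹` of the module of relations with `Ext³(k, A)`.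
    obtain ⟨i₀, hi₀, hall⟩ := MinimalGenerators.exists_unique_generator_of_ext (G := G₂) hinj hK
      (hproj 2 rfl) G₃ ((LinearMap.extKerEquiv G₁.proj_surjective _ 0).trans
        ((LinearMap.extKerEquiv hsurj _ 1).trans e))
    have hext : Subsingleton (Abelian.Ext (ModuleCat.of A (irrelevantModule 𝒜).carrier)
        (ModuleCat.of A A) 1) := by
      have := hvan 2 (by norm_num)
      exact (LinearMap.extKerEquiv (k := k) hsurj (ModuleCat.of A A) 0).injective.subsingleton
    have hδ : ∀ i, G₃.δ i₀ = G₂.δ i + 1 := MinimalGenerators.degree_eq_add_one hgen hall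
      fun b hb i => MinimalGenerators.mem_irrelevant_of_extension
        -- The syzygies of `G₂` are generated by the single element `G₃.gen i₀`, so vanishing of `b`
        -- on them is tested on that element.
        (LinearMap.exists_extension G₁.proj_surjective hext) (fun x => by
          obtain ⟨f, hf⟩ := G₃.proj_surjective x
          have hx : x = (f i₀) • G₃.gen i₀ := by
            have : f = Finsupp.single i₀ (f i₀) := by
              ext i
              rw [hi₀ i, Finsupp.single_eq_same]
            rw [← hf]
            conv_lhs => rw [this]
            rw [Finsupp.linearCombination_single]
          rw [hx]
          change Finsupp.linearCombination A b (f i₀ • (G₃.gen i₀).1) = 0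
          rw [map_smul, hb, smul_zero]) i
    obtain ⟨i₁, -⟩ := MinimalGenerators.exists_coeff_ne_zero G₃ i₀
    obtain ⟨m, hm, hm'⟩ := exists_degree_eq h hgen G₂ i₁
    have hδ₂ : ∀ i, G₂.δ i = (m + 1 : ℕ) := fun i => by
      have := hδ i
      have := hδ i₁
      omega
    refine ⟨m + 1, by omega, by omega, isNHomogeneous_of_degree h hgen hinj hfin hm G₂ hδ₂,
      isGeneralizedKoszul_of_degree h hgen fun j hj i => ?_⟩
    obtain rfl | hj := hj.eq_or_lt
    -- Stage `2` corresponds to `Tor_3`, and `n(3) = N + 1` with `N = m + 1`.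
    · have h3 : G₃.δ i = (m + 1 : ℕ) + 1 := by rw [hi₀ i, hδ i₁, hδ₂]
      refine h3.trans ?_
      simp [jumpMap]
    · exact ((isEmpty_stage h hgen (hproj 2 rfl) hj).false i).elim
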